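/- Let $(\mathcal M,\mathfrak g)$ be a finite-dimensional, geodesically complete smooth Riemannian manifold. For $x\in\mathcal M$ and $v\in T_x\mathcal M$ with $y=\mathrm{Exp}_x(v)$, let $\Gamma_x^y$ denote parallel transport (for the Levi-Civita connection) along the geodesic $t\mapsto \mathrm{Exp}_x(tv)$, $t\in[0,1]$, from $x$ to $y$. Consider the online problem $\min_{x\in\mathcal M} f(x)$, $f(x)=\mathbb E_{\xi\sim\mathcal D}[f(x,\xi)]$, with $f$ differentiable, and assume: * (geodesic $L$-smoothness, $L>0$) for every $\xi$, $f(\cdot,\xi)$ is differentiable and $\|\nabla f(x,\xi)-\Gamma_y^x\nabla f(y,\xi)\|\le L\|v\|$ for all $x$, $v\in T_x\mathcal M$, $y=\mathrm{Exp}_x(v)$, where $\Gamma_y^x=(\Gamma_x^y)^{-1}$; * (unbiasedness) $\mathbb E_{\xi}[\nabla f(x,\xi)]=\nabla f(x)$ for all $x$; * (bounded variance, $\sigma>0$) $\mathbb E_{\xi}\|\nabla f(x,\xi)-\nabla f(x)\|^2\le\sigma^2$ for all $x$; * (lower bound) $f(x)\ge f^*$ for all $x$. For i.i.d. samples $\xi_1,\dots,\xi_m\sim\mathcal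 D$ put $\nabla f_m(x)=\frac1m\sum_{i=1}^m\nabla f(x,\xi_i)$. R-PAGE started at $x^0\in\mathcal M$ computes $g^0=\nabla f_B(x^0)$ and, for $k=0,1,2,\dots$, $x^{k+1}=\mathrm{Exp}_{x^k}(-\eta g^k)$ and, with fresh samples and an independent coin, $$g^{k+1}=\begin{cases}\nabla f_B(x^{k+1}) & \text{with probability } p,\\ \Gamma_{x^k}^{x^{k+1}}(g^k)+\nabla f_b(x^{k+1})-\Gamma_{x^k}^{x^{k+1}}\big(\nabla f_b(x^k)\big) & \text{with probability } 1-p,\end{cases}$$ where the same $b$ samples are used at $x^{k+1}$ and at $x^k$. Let $\delta^0=f(x^0)-f^*$ and $\varepsilon>0$, and choose $$B=\Big\lceil\tfrac{2\sigma^2}{\varepsilon^2}\Big\rceil,\quad b\in\mathbb N,\ 1\le b\le\sqrt B,\quad p=\frac{b}{B+b},\quad \eta=\frac{1}{L\big(1+\sqrt{\frac{1-p}{pb}}\big)},\quad K=\Big\lceil\frac{4\delta^0}{\varepsilon^2\eta}+\frac1p\Big\rceil .$$ Let $\widehat x^K$ be chosen uniformly at random from $x^0,\dots,x^{K-1}$.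 Then $\widehat x^K$ is an $\varepsilon$-stationary point in expectation: $$\mathbb E\|\nabla f(\widehat x^K)\|^2\le\varepsilon^2,\qquad\text{and}\qquad \mathbb E\|\nabla f(\widehat x^K)\|\le\varepsilon .$$ Moreover, if $\varepsilon\le\sigma$, the expected number $\#\mathrm{grad}$ of stochastic gradients $\nabla f(x,\xi)$ computed in the initialization and these $K$ iterations ($B$ for $g^0$; in each iteration $B$ in the first case and $2b$ in the second) satisfies $$\mathbb E[\#\mathrm{grad}]\le 50\Big(\frac{\sigma^2}{\varepsilon^2}+\frac{L\delta^0\sigma}{\varepsilon^3}\Big),$$ that is, $\#\mathrm{grad}=\mathcal O\big(\frac{\sigma^2}{\varepsilon^2}+\frac{\sigma}{\varepsilon^3}\big)$ with a constant that depends only on $L\delta^0$. -/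

import Mathlib

open Bundle MeasureTheory
open scoped Manifold ContDiff

noncomputable section

namespace RPAGE

section Geometry

variable {E : Type*} [NormedAddCommGroup E] [NormedSpace ℝ E]
  {M : Type*} [TopologicalSpace M] [ChartedSpace E M] [IsManifold 𝓘(ℝ, E) ∞ M]
  [RiemannianBundle (fun x : M => TangentSpace 𝓘(ℝ, E) x)]

/-- The coefficient `g_y(a, b)` of the Riemannian metric in the chart centred at `x₀`: the inner
product of the two tangent vectors which have coordinates `a` and `b` in this chart, at the point
with coordinates `y`. -/
def metricCoeff (x₀ : M) (y a b : E) : ℝ :=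
  inner ℝ
    ((trivializationAt E (fun x : M => TangentSpace 𝓘(ℝ, E) x) x₀).symmL ℝ
      ((extChartAt 𝓘(ℝ, E) x₀).symm y) a)
    ((trivializationAt E (fun x : M => TangentSpace 𝓘(ℝ, E) x) x₀).symmL ℝ
      ((extChartAt 𝓘(ℝ, E) x₀).symm y) b)

/-- A vector field `V` along the curve `γ` is parallel for the Levi-Civita connection.
At time `t`, let `u` and `v` be the coordinates of `γ` and `V` in the chart centred at `γ t`.
The equation `v' + Γ_u(u', v) = 0` is paired with an arbitrary vector `a`, and the Christoffel
symbols are written out in terms of the metric: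
`2 g(Γ(u', v), a) = D_{u'} g(v, a) + D_v g(u', a) - D_a g(u', v)`. -/
def IsParallelAlong (γ : ℝ → M) (V : ∀ t, TangentSpace 𝓘(ℝ, E) (γ t)) : Prop :=
  MDifferentiable 𝓘(ℝ, ℝ) 𝓘(ℝ, E).tangent (fun t => (⟨γ t, V t⟩ : TangentBundle 𝓘(ℝ, E) M)) ∧
  ∀ (t : ℝ) (a : E),
    let u : ℝ → E := fun s => extChartAt 𝓘(ℝ, E) (γ t) (γ s)
    let v : ℝ → E := fun s =>
      (trivializationAt E (fun x : M => TangentSpace 𝓘(ℝ, E) x) (γ t)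
        (⟨γ s, V s⟩ : TangentBundle 𝓘(ℝ, E) M)).2
    2 * metricCoeff (γ t) (u t) (deriv v t) a
      + fderiv ℝ (fun y => metricCoeff (γ t) y (v t) a) (u t) (deriv u t)
      + fderiv ℝ (fun y => metricCoeff (γ t) y (deriv u t) a) (u t) (v t)
      - fderiv ℝ (fun y => metricCoeff (γ t) y (deriv u t) (v t)) (u t) a = 0

/-- The velocity `γ'(t)` of a curve. -/
def velocity (γ : ℝ → M) (t : ℝ) : TangentSpace 𝓘(ℝ, E) (γ t) :=
  mfderiv 𝓘(ℝ, ℝ) 𝓘(ℝ, E) γ t (1 : ℝ)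

/-- Geodesics: curves whose velocity is parallel along them. -/
def IsGeodesic (γ : ℝ → M) : Prop := IsParallelAlong γ (fun t => velocity (E := E) γ t)

/-- `γ` is a geodesic defined for all times whose initial point and initial velocity are given by
the tangent vector `v`. -/
def IsGeodesicFrom (v : TangentBundle 𝓘(ℝ, E) M) (γ : ℝ → M) : Prop :=
  IsGeodesic (E := E) γ ∧ (⟨γ 0, velocity γ 0⟩ : TangentBundle 𝓘(ℝ, E) M) = v

variable (E M) in
/-- Geodesic completeness: the exponential map is defined on the whole tangent bundle. -/
def GeodesicallyComplete : Prop :=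
  ∀ v : TangentBundle 𝓘(ℝ, E) M, ∃ γ : ℝ → M, IsGeodesicFrom v γ

open Classical in
/-- The geodesic with initial velocity `v` (a constant curve if there is none). -/
def geodesic (v : TangentBundle 𝓘(ℝ, E) M) : ℝ → M :=
  if h : ∃ γ : ℝ → M, IsGeodesicFrom v γ then h.choose else fun _ => v.proj

/-- The Riemannian exponential map. -/
def expMap (v : TangentBundle 𝓘(ℝ, E) M) : M := geodesic v 1

/-- `w'` is the parallel transport of `w` along `γ` from time `a` to time `b`. -/
def IsParallelTransport (γ : ℝ → M) (a b : ℝ) (w : TangentSpace 𝓘(ℝ, E) (γ a))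
    (w' : TangentSpace 𝓘(ℝ, E) (γ b)) : Prop :=
  ∃ V : ∀ t, TangentSpace 𝓘(ℝ, E) (γ t), IsParallelAlong γ V ∧ V a = w ∧ V b = w'

open Classical in
/-- `transport v w` is the parallel transport of `w ∈ T_x M` to `T_y M`, `y = Exp_x v`, along the
geodesic `t ↦ Exp_x (t v)`, `0 ≤ t ≤ 1`; here `x` is the base point of `v`. -/
def transport (v : TangentBundle 𝓘(ℝ, E) M) (w : TangentSpace 𝓘(ℝ, E) v.proj) :
    TangentSpace 𝓘(ℝ, E) (expMap v) :=
  if h : ∃ V : ∀ t, TangentSpace 𝓘(ℝ, E) (geodesic v t), IsParallelAlong (geodesic v) V ∧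
      (⟨geodesic v 0, V 0⟩ : TangentBundle 𝓘(ℝ, E) M) = ⟨v.proj, w⟩
  then h.choose 1 else 0

variable [FiniteDimensional ℝ E]

/-- The Riemannian gradient: `⟨∇f(x), w⟩ = df(x) w` for all `w ∈ T_x M`. -/
def grad (f : M → ℝ) (x : M) : TangentSpace 𝓘(ℝ, E) x :=
  haveI : FiniteDimensional ℝ (TangentSpace 𝓘(ℝ, E) x) := inferInstanceAs (FiniteDimensional ℝ E)
  haveI : CompleteSpace (TangentSpace 𝓘(ℝ, E) x) := FiniteDimensional.complete ℝ _
  (InnerProductSpace.toDual ℝ (TangentSpace 𝓘(ℝ, E) x)).symm (mvfderiv 𝓘(ℝ, E) f x)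

variable (E) in
/-- A geodesically `L`-smooth function: for each geodesic `γ` from `x = γ 0` to `y = γ 1`, so that
`γ'(0)` is `Exp_x⁻¹ y`, one has `‖∇f(x) - Γ_y^x ∇f(y)‖ ≤ L ‖Exp_x⁻¹ y‖`, with `Γ_y^x` the parallel
transport along `γ`. -/
def IsGeodesicallySmooth (L : ℝ) (f : M → ℝ) : Prop :=
  MDifferentiable 𝓘(ℝ, E) 𝓘(ℝ, ℝ) f ∧
  ∀ γ : ℝ → M, IsGeodesic (E := E) γ →
    ∃ w : TangentSpace 𝓘(ℝ, E) (γ 0), IsParallelTransport γ 1 0 (grad f (γ 1)) w ∧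
      ‖grad f (γ 0) - w‖ ≤ L * ‖velocity (E := E) γ 0‖

/-! ### The algorithm -/

variable {Ξ : Type*}

variable (E) in
/-- The minibatch stochastic gradient at `x` for the samples `ξ₁, …, ξ_m`. -/
def batchGrad (F : M → Ξ → ℝ) {m : ℕ} (ξ : Fin m → Ξ) (x : M) : TangentSpace 𝓘(ℝ, E) x :=
  (m : ℝ)⁻¹ • ∑ i, grad (fun y => F y (ξ i)) x

/-- The randomness of one iteration: the coin (`true` has probability `p`), the large minibatch and
the small minibatch. -/
abbrev StepSample (Ξ : Type*) (B b : ℕ) : Type _ := Bool × (Fin B → Ξ) × (Fin b → Ξ)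

/-- One iteration of R-PAGE, mapping the pair `(x^k, g^k)`, a tangent vector, to
`(x^{k+1}, g^{k+1})`. -/
def step (F : M → Ξ → ℝ) (η : ℝ) {B b : ℕ} (z : TangentBundle 𝓘(ℝ, E) M)
    (s : StepSample Ξ B b) : TangentBundle 𝓘(ℝ, E) M :=
  let v : TangentBundle 𝓘(ℝ, E) M := ⟨z.proj, -(η • z.snd)⟩
  ⟨expMap v,
    if s.1 = true then batchGrad E F s.2.1 (expMap v)
    else transport v z.snd + batchGrad E F s.2.2 (expMap v)
      - transport v (batchGrad E F s.2.2 z.proj)⟩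

/-- The iterates `(x^0, g^0), …, (x^K, g^K)` of R-PAGE started at `x₀`, as a function of the initial
minibatch `r.1` and of the randomness `r.2` of the `K` iterations. -/
def iterates (F : M → Ξ → ℝ) (η : ℝ) (x₀ : M) {B b K : ℕ}
    (r : (Fin B → Ξ) × (Fin K → StepSample Ξ B b)) : Fin (K + 1) → TangentBundle 𝓘(ℝ, E) M :=
  Fin.induction (motive := fun _ => TangentBundle 𝓘(ℝ, E) M)
    ⟨x₀, batchGrad E F r.1 x₀⟩ (fun k z => step F η z (r.2 k))

end Geometry

section Probability

variable {Ξ : Type*} [MeasurableSpace Ξ]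

/-- The law of the randomness of one iteration: a coin with success probability `p` and two
minibatches of independent samples from `D`, all independent. -/
def stepLaw (D : Measure Ξ) (B b : ℕ) (p : ℝ) : Measure (StepSample Ξ B b) :=
  (ENNReal.ofReal p • Measure.dirac true + ENNReal.ofReal (1 - p) • Measure.dirac false).prod
    ((Measure.pi fun _ => D).prod (Measure.pi fun _ => D))

/-- The law of the whole randomness of `K` iterations of R-PAGE. -/
def runLaw (D : Measure Ξ) (B b : ℕ) (p : ℝ) (K : ℕ) :
    Measure ((Fin B → Ξ) × (Fin K → StepSample Ξ B b)) :=
  (Measure.pi fun _ => D).prod (Measure.pi fun _ => stepLaw D B b p)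

/-- The number of stochastic gradients `∇f(x, ξ)` computed in `K` iterations: `B` for `g^0`, and for
each iteration `B` if the coin shows `true`, and otherwise `2 b`, as each of the `b` samples is
evaluated both at `x^{k+1}` and at `x^k`. -/
def gradCount {B b K : ℕ} (r : (Fin B → Ξ) × (Fin K → StepSample Ξ B b)) : ℕ :=
  B + ∑ k, if (r.2 k).1 = true then B else 2 * b

end Probability

end RPAGE

end

/-! The proof follows a Lyapunov function: the gap `f x - fstar` plus `η / (2 * p)` times the
squared estimator error ‖g - ∇f(x)‖². The descent inequality controls the new gap in terms of this
error. With probability p the error is reset to at most σ²/B on average; otherwise it grows on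
average by at most (Lη‖g‖)²/b, the variance of a minibatch mean of transported gradient differences.
The weight and the step size make the error and ‖g‖² terms cancel, so each step gains (η/2)‖∇f(x)‖²
up to noise ησ²/(2B) (`lyapunov_decrease`). Summation over the run (`lintegral_pi_sum_orbit_le`)
bounds the mean square, and Cauchy–Schwarz then bounds the mean.

Geometry enters through the constancy of inner products of parallel fields
(`IsParallelAlong.hasDerivAt_inner`), which makes transport isometric and unique. Parallel
extensions of arbitrary vectors are never needed: the method transports only multiples of the
velocity, and minibatch gradients, whose extension is part of the smoothness hypothesis. An
orthogonal projection onto the extendable vectors turns transport into a linear contraction of the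
whole tangent space (`GeodesicallyComplete.exists_transport_clm`), which commutes with expectations.

The iterates are not known to be measurable in the samples. Hence expectations along a run are lower
integrals, bounded only by inequalities valid for arbitrary functions. -/

noncomputable section

namespace RPAGE

/-! ### Metric coefficients in charts and the covariant derivative -/

section ParallelFields

variable {E : Type*} [NormedAddCommGroup E] [NormedSpace ℝ E]
  {M : Type*} [TopologicalSpace M] [ChartedSpace E M] [IsManifold 𝓘(ℝ, E) ∞ M]

/-- Read in the trivialization at `x₀`, the vector component is `ψ` itself near `n`. Base point and
vector vary together, as needed to differentiate the metric jointly. -/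
lemma mdifferentiableAt_symmL (x₀ : M) {y : E} (hy : y ∈ (extChartAt 𝓘(ℝ, E) x₀).target)
    {N : Type*} [NormedAddCommGroup N] [NormedSpace ℝ N] {φ ψ : N → E} {n : N}
    (hφ : DifferentiableAt ℝ φ n) (hψ : DifferentiableAt ℝ ψ n) (hn : φ n = y) :
    MDifferentiableAt 𝓘(ℝ, N) 𝓘(ℝ, E).tangent
      (fun q : N => (⟨(extChartAt 𝓘(ℝ, E) x₀).symm (φ q),
        (trivializationAt E (fun x : M => TangentSpace 𝓘(ℝ, E) x) x₀).symmL ℝ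
          ((extChartAt 𝓘(ℝ, E) x₀).symm (φ q)) (ψ q)⟩ : TangentBundle 𝓘(ℝ, E) M)) n := by
  subst hn
  have hb : MDifferentiableAt 𝓘(ℝ, N) 𝓘(ℝ, E)
      (fun q : N => (extChartAt 𝓘(ℝ, E) x₀).symm (φ q)) n := by
    have h1 : MDifferentiableAt 𝓘(ℝ, E) 𝓘(ℝ, E) (extChartAt 𝓘(ℝ, E) x₀).symm (φ n) :=
      ((contMDiffOn_extChartAt_symm (n := ∞) x₀).contMDiffAt
        ((isOpen_extChartAt_target x₀).mem_nhds hy)).mdifferentiableAt (by simp)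
    exact h1.comp n hφ.mdifferentiableAt
  have hmem : (extChartAt 𝓘(ℝ, E) x₀).symm (φ n) ∈
      (trivializationAt E (fun x : M => TangentSpace 𝓘(ℝ, E) x) x₀).baseSet := by
    have := (extChartAt 𝓘(ℝ, E) x₀).map_target hy
    rwa [extChartAt_source] at this
  have hev := hb.continuousAt.preimage_mem_nhds
    ((trivializationAt E (fun x : M => TangentSpace 𝓘(ℝ, E) x) x₀).open_baseSet.mem_nhds hmem)
  refine (Trivialization.mdifferentiableAt_totalSpace_iff 𝓘(ℝ, E)
    (trivializationAt E (fun x : M => TangentSpace 𝓘(ℝ, E) x) x₀) _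
    ((Trivialization.mem_source _).2 hmem)).2 ⟨hb, ?_⟩
  refine hψ.mdifferentiableAt.congr_of_eventuallyEq ?_
  filter_upwards [hev] with q hq
  rw [← Trivialization.continuousLinearMapAt_apply_of_mem (R := ℝ) _ hq,
    Trivialization.continuousLinearMapAt_symmL _ hq]

variable [RiemannianBundle (fun x : M => TangentSpace 𝓘(ℝ, E) x)]

lemma metricCoeff_comm (x₀ : M) (y a b : E) : metricCoeff x₀ y a b = metricCoeff x₀ y b a :=
  real_inner_comm _ _

lemma metricCoeff_add_left (x₀ : M) (y a a' b : E) :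
    metricCoeff x₀ y (a + a') b = metricCoeff x₀ y a b + metricCoeff x₀ y a' b := by
  simp only [metricCoeff, map_add, inner_add_left]

lemma metricCoeff_smul_left (x₀ : M) (y : E) (c : ℝ) (a b : E) :
    metricCoeff x₀ y (c • a) b = c * metricCoeff x₀ y a b := by
  simp only [metricCoeff, map_smul, real_inner_smul_left]

lemma metricCoeff_add_right (x₀ : M) (y a b b' : E) :
    metricCoeff x₀ y a (b + b') = metricCoeff x₀ y a b + metricCoeff x₀ y a b' := by
  simp only [metricCoeff, map_add, inner_add_right]

lemma metricCoeff_smul_right (x₀ : M) (y : E) (c : ℝ) (a b : E) :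
    metricCoeff x₀ y a (c • b) = c * metricCoeff x₀ y a b := by
  simp only [metricCoeff, map_smul, real_inner_smul_right]

/-- The coordinates of a curve in the chart centred at its point at time `t`. -/
def chartCurve (γ : ℝ → M) (t s : ℝ) : E := extChartAt 𝓘(ℝ, E) (γ t) (γ s)

/-- The coordinates of a vector field along a curve in the chart centred at the point of the curve
at time `t`. -/
def chartField (γ : ℝ → M) (V : ∀ t, TangentSpace 𝓘(ℝ, E) (γ t)) (t s : ℝ) : E :=
  (trivializationAt E (fun x : M => TangentSpace 𝓘(ℝ, E) x) (γ t)
    (⟨γ s, V s⟩ : TangentBundle 𝓘(ℝ, E) M)).2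

/-- Twice the inner product of `a` and the covariant derivative of a field with coordinates `v`,
with derivative `v'`, along a curve through `y` with velocity `u'`. -/
def covariantPairing (x₀ : M) (y u' v v' a : E) : ℝ :=
  2 * metricCoeff x₀ y v' a
    + fderiv ℝ (fun y => metricCoeff x₀ y v a) y u'
    + fderiv ℝ (fun y => metricCoeff x₀ y u' a) y v
    - fderiv ℝ (fun y => metricCoeff x₀ y u' v) y a

lemma fderiv_const_mul_metricCoeff (x₀ : M) (y a b : E) (c : ℝ) :
    fderiv ℝ (fun y => c * metricCoeff x₀ y a b) y
      = c • fderiv ℝ (fun y => metricCoeff x₀ y a b) y :=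
  congrFun (fderiv_const_smul_field (f := fun y => metricCoeff x₀ y a b) c) y

lemma covariantPairing_smul (x₀ : M) (y : E) (c : ℝ) (u' v v' a : E) :
    covariantPairing x₀ y u' (c • v) (c • v') a = c * covariantPairing x₀ y u' v v' a := by
  simp only [covariantPairing, metricCoeff_smul_left, metricCoeff_smul_right, map_smul,
    fderiv_const_mul_metricCoeff,
    smul_apply, smul_eq_mul]
  ring

/-- Each term is linear in the pair `(u', v')`, which an affine change of time scales by one factor;
so parallelism survives reparametrization. -/
lemma covariantPairing_smul_velocity (x₀ : M) (y : E) (c : ℝ) (u' v v' a : E) :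
    covariantPairing x₀ y (c • u') v (c • v') a = c * covariantPairing x₀ y u' v v' a := by
  simp only [covariantPairing, metricCoeff_smul_left, map_smul,
    fderiv_const_mul_metricCoeff,
    smul_apply, smul_eq_mul]
  ring

lemma isParallelAlong_iff {γ : ℝ → M} {V : ∀ t, TangentSpace 𝓘(ℝ, E) (γ t)} :
    IsParallelAlong γ V ↔
      MDifferentiable 𝓘(ℝ, ℝ) 𝓘(ℝ, E).tangent
        (fun t => (⟨γ t, V t⟩ : TangentBundle 𝓘(ℝ, E) M)) ∧
      ∀ (t : ℝ) (a : E), covariantPairing (γ t) (chartCurve γ t t) (deriv (chartCurve γ t) t)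
        (chartField γ V t t) (deriv (chartField γ V t) t) a = 0 := Iff.rfl

variable [IsContMDiffRiemannianBundle 𝓘(ℝ, E) ∞ E (fun x : M => TangentSpace 𝓘(ℝ, E) x)]

lemma differentiableAt_metricCoeff (x₀ : M) {y : E} (hy : y ∈ (extChartAt 𝓘(ℝ, E) x₀).target)
    {N : Type*} [NormedAddCommGroup N] [NormedSpace ℝ N] {φ ψ χ : N → E} {n : N}
    (hφ : DifferentiableAt ℝ φ n) (hψ : DifferentiableAt ℝ ψ n) (hχ : DifferentiableAt ℝ χ n)
    (hn : φ n = y) :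
    DifferentiableAt ℝ (fun q => metricCoeff x₀ (φ q) (ψ q) (χ q)) n := by
  have h := MDifferentiableAt.inner_bundle (IB := 𝓘(ℝ, E)) (F := E) (IM := 𝓘(ℝ, N))
    (E := fun x : M => TangentSpace 𝓘(ℝ, E) x)
    (b := fun q : N => (extChartAt 𝓘(ℝ, E) x₀).symm (φ q))
    (v := fun q => (trivializationAt E (fun x : M => TangentSpace 𝓘(ℝ, E) x) x₀).symmL ℝ
      ((extChartAt 𝓘(ℝ, E) x₀).symm (φ q)) (ψ q))
    (w := fun q => (trivializationAt E (fun x : M => TangentSpace 𝓘(ℝ, E) x) x₀).symmL ℝ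
      ((extChartAt 𝓘(ℝ, E) x₀).symm (φ q)) (χ q))
    (mdifferentiableAt_symmL x₀ hy hφ hψ hn)
    (mdifferentiableAt_symmL x₀ hy hφ hχ hn)
  exact h.differentiableAt

lemma hasDerivAt_metricCoeff (x₀ : M) {u v w : ℝ → E} {u' v' w' : E} {t : ℝ}
    (hy : u t ∈ (extChartAt 𝓘(ℝ, E) x₀).target)
    (hu : HasDerivAt u u' t) (hv : HasDerivAt v v' t) (hw : HasDerivAt w w' t) :
    HasDerivAt (fun s => metricCoeff x₀ (u s) (v s) (w s))
      (fderiv ℝ (fun y => metricCoeff x₀ y (v t) (w t)) (u t) u'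
        + metricCoeff x₀ (u t) v' (w t) + metricCoeff x₀ (u t) (v t) w') t := by
  set Φ : E × E × E → ℝ := fun q => metricCoeff x₀ q.1 q.2.1 q.2.2
  have hΦ : HasFDerivAt Φ (fderiv ℝ Φ (u t, v t, w t)) (u t, v t, w t) :=
    (differentiableAt_metricCoeff x₀ hy (φ := fun q : E × E × E => q.1)
      (ψ := fun q => q.2.1) (χ := fun q => q.2.2) (by fun_prop) (by fun_prop) (by fun_prop)
      rfl).hasFDerivAt
  have key := hΦ.comp_hasDerivAt t (hu.prodMk (hv.prodMk hw))
  -- The total derivative splits into three partial ones. In either vector slot the function is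
  -- affine along a line, so uniqueness of derivatives identifies the value.
  have e1 : fderiv ℝ Φ (u t, v t, w t) (u', 0, 0)
      = fderiv ℝ (fun y => metricCoeff x₀ y (v t) (w t)) (u t) u' := by
    have : HasFDerivAt (fun y => metricCoeff x₀ y (v t) (w t)) _ (u t) :=
      HasFDerivAt.comp (g := Φ) (f := fun y => (y, v t, w t)) (u t) hΦ ((hasFDerivAt_id (u t)).prodMk (hasFDerivAt_const (v t, w t) (u t)))
    rw [this.fderiv]
    rfl
  have e2 : fderiv ℝ Φ (u t, v t, w t) (0, v', 0) = metricCoeff x₀ (u t) v' (w t) := by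
    have h1 : HasDerivAt (fun s : ℝ => metricCoeff x₀ (u t) (v t + s • v') (w t)) _ 0 :=
      HasFDerivAt.comp_hasDerivAt (l := Φ) (f := fun s : ℝ => (u t, v t + s • v', w t)) 0
        (by simpa using hΦ) ((hasDerivAt_const 0 (u t)).prodMk
        ((((hasDerivAt_id (0 : ℝ)).smul_const v').const_add (v t)).prodMk
          (hasDerivAt_const 0 (w t))))
    have h2 : HasDerivAt (fun s : ℝ => metricCoeff x₀ (u t) (v t + s • v') (w t))
        (metricCoeff x₀ (u t) v' (w t)) 0 := by
      simp only [metricCoeff_add_left, metricCoeff_smul_left]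
      simpa using ((hasDerivAt_id (0 : ℝ)).mul_const (metricCoeff x₀ (u t) v' (w t))).const_add
        (metricCoeff x₀ (u t) (v t) (w t))
    simpa using h1.unique h2
  have e3 : fderiv ℝ Φ (u t, v t, w t) (0, 0, w') = metricCoeff x₀ (u t) (v t) w' := by
    have h1 : HasDerivAt (fun s : ℝ => metricCoeff x₀ (u t) (v t) (w t + s • w')) _ 0 :=
      HasFDerivAt.comp_hasDerivAt (l := Φ) (f := fun s : ℝ => (u t, v t, w t + s • w')) 0
        (by simpa using hΦ) ((hasDerivAt_const 0 (u t)).prodMk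
        ((hasDerivAt_const 0 (v t)).prodMk
          (((hasDerivAt_id (0 : ℝ)).smul_const w').const_add (w t))))
    have h2 : HasDerivAt (fun s : ℝ => metricCoeff x₀ (u t) (v t) (w t + s • w'))
        (metricCoeff x₀ (u t) (v t) w') 0 := by
      simp only [metricCoeff_add_right, metricCoeff_smul_right]
      simpa using ((hasDerivAt_id (0 : ℝ)).mul_const (metricCoeff x₀ (u t) (v t) w')).const_add
        (metricCoeff x₀ (u t) (v t) (w t))
    simpa using h1.unique h2
  have e0 : (u', v', w') = (u', (0 : E), (0 : E)) + (0, v', 0) + (0, 0, w') := by simp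
  rw [e0, map_add, map_add, e1, e2, e3] at key
  exact key

/-- Unlike scaling, splitting the derivative of a sum needs differentiable coefficients, hence a
point of the chart target. -/
lemma covariantPairing_add {x₀ : M} {y : E} (hy : y ∈ (extChartAt 𝓘(ℝ, E) x₀).target)
    (u' v v' w w' a : E) :
    covariantPairing x₀ y u' (v + w) (v' + w') a =
      covariantPairing x₀ y u' v v' a + covariantPairing x₀ y u' w w' a := by
  have hd (a b : E) : DifferentiableAt ℝ (fun y => metricCoeff x₀ y a b) y :=
    differentiableAt_metricCoeff x₀ hy (φ := fun y => y) (ψ := fun _ => a) (χ := fun _ => b)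
      (by fun_prop) (by fun_prop) (by fun_prop) rfl
  simp only [covariantPairing, metricCoeff_add_left, metricCoeff_add_right, map_add]
  rw [fderiv_fun_add (hd _ _) (hd _ _), fderiv_fun_add (hd _ _) (hd _ _)]
  simp only [add_apply]
  ring

end ParallelFields

/-! ### Parallel fields along curves -/

section ParallelFieldsAlongCurves

variable {E : Type*} [NormedAddCommGroup E] [NormedSpace ℝ E]
  {M : Type*} [TopologicalSpace M] [ChartedSpace E M]
  {γ : ℝ → M} {V W : ∀ t, TangentSpace 𝓘(ℝ, E) (γ t)}

lemma differentiableAt_chartCurve (hγ : MDifferentiable 𝓘(ℝ, ℝ) 𝓘(ℝ, E) γ) (t : ℝ) :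
    DifferentiableAt ℝ (chartCurve γ t : ℝ → E) t := by
  have h : MDifferentiableAt 𝓘(ℝ, E) 𝓘(ℝ, E) (extChartAt 𝓘(ℝ, E) (γ t)) (γ t) :=
    (contMDiffAt_extChartAt (n := ∞)).mdifferentiableAt (by simp)
  exact (h.comp t (hγ t)).differentiableAt

lemma chartCurve_mem_target (γ : ℝ → M) (t : ℝ) :
    (chartCurve γ t t : E) ∈ (extChartAt 𝓘(ℝ, E) (γ t)).target :=
  mem_extChartAt_target (γ t)

lemma velocity_comp_affine (hγ : MDifferentiable 𝓘(ℝ, ℝ) 𝓘(ℝ, E) γ) (c d t : ℝ) :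
    velocity (E := E) (fun t => γ (c * t + d)) t = c • velocity (E := E) γ (c * t + d) := by
  have haff : HasDerivAt (fun t : ℝ => c * t + d) c t := by
    simpa using ((hasDerivAt_id t).const_mul c).add_const d
  have h := mfderiv_comp_apply (I := 𝓘(ℝ, ℝ)) (I' := 𝓘(ℝ, ℝ)) (I'' := 𝓘(ℝ, E))
    (g := γ) (f := fun t : ℝ => c * t + d) t (hγ (c * t + d))
    haff.differentiableAt.mdifferentiableAt (1 : ℝ)
  have h' : mfderiv 𝓘(ℝ, ℝ) 𝓘(ℝ, ℝ) (fun t : ℝ => c * t + d) t (1 : ℝ) = c • (1 : ℝ) := by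
    rw [mfderiv_eq_fderiv, haff.hasFDerivAt.fderiv]
    exact mul_comm (1 : ℝ) c
  rw [h'] at h
  refine h.trans ?_
  exact (mfderiv 𝓘(ℝ, ℝ) 𝓘(ℝ, E) γ (c * t + d)).map_smul c (1 : ℝ)

variable [IsManifold 𝓘(ℝ, E) ∞ M]

lemma mdifferentiable_of_mdifferentiable_field
    (hV : MDifferentiable 𝓘(ℝ, ℝ) 𝓘(ℝ, E).tangent
      (fun t => (⟨γ t, V t⟩ : TangentBundle 𝓘(ℝ, E) M))) :
    MDifferentiable 𝓘(ℝ, ℝ) 𝓘(ℝ, E) γ :=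
  fun t => ((mdifferentiableAt_totalSpace 𝓘(ℝ, E) _).1 (hV t)).1

lemma differentiableAt_chartField
    (hV : MDifferentiable 𝓘(ℝ, ℝ) 𝓘(ℝ, E).tangent
      (fun t => (⟨γ t, V t⟩ : TangentBundle 𝓘(ℝ, E) M))) (t : ℝ) :
    DifferentiableAt ℝ (chartField γ V t) t :=
  ((mdifferentiableAt_totalSpace 𝓘(ℝ, E) _).1 (hV t)).2.differentiableAt

lemma mdifferentiable_field_iff (hγ : MDifferentiable 𝓘(ℝ, ℝ) 𝓘(ℝ, E) γ) :
    MDifferentiable 𝓘(ℝ, ℝ) 𝓘(ℝ, E).tangent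
      (fun t => (⟨γ t, V t⟩ : TangentBundle 𝓘(ℝ, E) M)) ↔
    ∀ t, DifferentiableAt ℝ (chartField γ V t) t :=
  ⟨differentiableAt_chartField, fun h t => (mdifferentiableAt_totalSpace 𝓘(ℝ, E) _).2
    ⟨hγ t, (h t).mdifferentiableAt⟩⟩

lemma eventually_mem_baseSet (hγ : MDifferentiable 𝓘(ℝ, ℝ) 𝓘(ℝ, E) γ) (t : ℝ) :
    ∀ᶠ s in nhds t, γ s ∈
      (trivializationAt E (fun x : M => TangentSpace 𝓘(ℝ, E) x) (γ t)).baseSet :=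
  (hγ t).continuousAt.preimage_mem_nhds
    ((trivializationAt E (fun x : M => TangentSpace 𝓘(ℝ, E) x) (γ t)).open_baseSet.mem_nhds
      (FiberBundle.mem_baseSet_trivializationAt' (γ t)))

lemma chartField_eq_continuousLinearMapAt {t s : ℝ}
    (hs : γ s ∈ (trivializationAt E (fun x : M => TangentSpace 𝓘(ℝ, E) x) (γ t)).baseSet) :
    chartField γ V t s =
      (trivializationAt E (fun x : M => TangentSpace 𝓘(ℝ, E) x) (γ t)).continuousLinearMapAt ℝ
        (γ s) (V s) :=
  (Trivialization.continuousLinearMapAt_apply_of_mem (R := ℝ) _ hs _).symm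

/-- The trivialization is linear only over its base set, so the identity is local in time; that
suffices for derivatives. -/
lemma chartField_add (hγ : MDifferentiable 𝓘(ℝ, ℝ) 𝓘(ℝ, E) γ) (t : ℝ) :
    chartField γ (fun s => V s + W s) t =ᶠ[nhds t]
      fun s => chartField γ V t s + chartField γ W t s := by
  filter_upwards [eventually_mem_baseSet hγ t] with s hs
  simp only [chartField_eq_continuousLinearMapAt hs, map_add]

lemma chartField_smul (hγ : MDifferentiable 𝓘(ℝ, ℝ) 𝓘(ℝ, E) γ) (c t : ℝ) :
    chartField γ (fun s => c • V s) t =ᶠ[nhds t] fun s => c • chartField γ V t s := by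
  filter_upwards [eventually_mem_baseSet hγ t] with s hs
  simp only [chartField_eq_continuousLinearMapAt hs, map_smul]

variable [RiemannianBundle (fun x : M => TangentSpace 𝓘(ℝ, E) x)]

lemma inner_eq_metricCoeff (hγ : MDifferentiable 𝓘(ℝ, ℝ) 𝓘(ℝ, E) γ) (t : ℝ) :
    (fun s => inner ℝ (V s) (W s)) =ᶠ[nhds t] fun s =>
      metricCoeff (γ t) (chartCurve γ t s) (chartField γ V t s) (chartField γ W t s) := by
  filter_upwards [eventually_mem_baseSet hγ t] with s hs
  have hs' : γ s ∈ (extChartAt 𝓘(ℝ, E) (γ t)).source := by rwa [extChartAt_source]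
  have h1 : (extChartAt 𝓘(ℝ, E) (γ t)).symm (chartCurve γ t s) = γ s :=
    (extChartAt 𝓘(ℝ, E) (γ t)).left_inv hs'
  rw [metricCoeff, h1, chartField_eq_continuousLinearMapAt hs,
    chartField_eq_continuousLinearMapAt hs, Trivialization.symmL_continuousLinearMapAt _ hs,
    Trivialization.symmL_continuousLinearMapAt _ hs]

lemma IsParallelAlong.mdifferentiable (hV : IsParallelAlong γ V) :
    MDifferentiable 𝓘(ℝ, ℝ) 𝓘(ℝ, E) γ :=
  mdifferentiable_of_mdifferentiable_field hV.1

lemma IsParallelAlong.smul (c : ℝ) (hV : IsParallelAlong γ V) :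
    IsParallelAlong γ (fun t => c • V t) := by
  have hγ := hV.mdifferentiable
  refine isParallelAlong_iff.2 ⟨(mdifferentiable_field_iff hγ).2 fun t =>
    ((differentiableAt_chartField hV.1 t).const_smul c).congr_of_eventuallyEq
      (chartField_smul hγ c t), fun t a => ?_⟩
  rw [(chartField_smul hγ c t).deriv_eq, (chartField_smul hγ c t).eq_of_nhds,
    deriv_fun_const_smul c (differentiableAt_chartField hV.1 t), covariantPairing_smul,
    (isParallelAlong_iff.1 hV).2 t a, mul_zero]

lemma IsParallelAlong.comp_affine (hV : IsParallelAlong γ V) (c d : ℝ) :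
    IsParallelAlong (fun t => γ (c * t + d)) (fun t => V (c * t + d)) := by
  have hγ := hV.mdifferentiable
  have haff (t : ℝ) : HasDerivAt (fun t : ℝ => c * t + d) c t := by
    simpa using ((hasDerivAt_id t).const_mul c).add_const d
  refine isParallelAlong_iff.2 ⟨fun t => ?_, fun t a => ?_⟩
  · exact (hV.1 (c * t + d)).comp t (haff t).differentiableAt.mdifferentiableAt
  · have h1 : HasDerivAt (chartCurve (E := E) (fun t => γ (c * t + d)) t)
        (c • deriv (chartCurve γ (c * t + d)) (c * t + d)) t :=
      HasDerivAt.scomp (g₁ := chartCurve γ (c * t + d)) t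
        (differentiableAt_chartCurve hγ (c * t + d)).hasDerivAt (haff t)
    have h2 : HasDerivAt (chartField (fun t => γ (c * t + d)) (fun t => V (c * t + d)) t)
        (c • deriv (chartField γ V (c * t + d)) (c * t + d)) t :=
      HasDerivAt.scomp (g₁ := chartField γ V (c * t + d)) t
        (differentiableAt_chartField hV.1 (c * t + d)).hasDerivAt (haff t)
    rw [h1.deriv, h2.deriv, covariantPairing_smul_velocity]
    exact mul_eq_zero_of_right c ((isParallelAlong_iff.1 hV).2 (c * t + d) a)

lemma IsGeodesic.mdifferentiable (hγ : IsGeodesic (E := E) γ) :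
    MDifferentiable 𝓘(ℝ, ℝ) 𝓘(ℝ, E) γ :=
  IsParallelAlong.mdifferentiable hγ

lemma IsGeodesic.comp_affine (hγ : IsGeodesic (E := E) γ) (c d : ℝ) :
    IsGeodesic (E := E) (fun t => γ (c * t + d)) := by
  have h := (IsParallelAlong.comp_affine hγ c d).smul c
  have e : (fun t => velocity (E := E) (fun t => γ (c * t + d)) t) =
      fun t => c • velocity (E := E) γ (c * t + d) :=
    funext fun t => velocity_comp_affine hγ.mdifferentiable c d t
  unfold IsGeodesic
  rw [e]
  exact h

variable [IsContMDiffRiemannianBundle 𝓘(ℝ, E) ∞ E (fun x : M => TangentSpace 𝓘(ℝ, E) x)]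

lemma IsParallelAlong.add (hV : IsParallelAlong γ V) (hW : IsParallelAlong γ W) :
    IsParallelAlong γ (fun t => V t + W t) := by
  have hγ := hV.mdifferentiable
  refine isParallelAlong_iff.2 ⟨(mdifferentiable_field_iff hγ).2 fun t =>
    ((differentiableAt_chartField hV.1 t).add
      (differentiableAt_chartField hW.1 t)).congr_of_eventuallyEq (chartField_add hγ t),
      fun t a => ?_⟩
  rw [(chartField_add hγ t).deriv_eq, (chartField_add hγ t).eq_of_nhds,
    deriv_fun_add (differentiableAt_chartField hV.1 t) (differentiableAt_chartField hW.1 t),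
    covariantPairing_add (chartCurve_mem_target γ t),
    (isParallelAlong_iff.1 hV).2 t a, (isParallelAlong_iff.1 hW).2 t a, add_zero]

/-- The Levi-Civita connection is compatible with the metric. -/
lemma IsParallelAlong.hasDerivAt_inner (hV : IsParallelAlong γ V) (hW : IsParallelAlong γ W)
    (t : ℝ) : HasDerivAt (fun s => inner ℝ (V s) (W s)) 0 t := by
  have hγ := hV.mdifferentiable
  have h := (hasDerivAt_metricCoeff (γ t) (chartCurve_mem_target γ t)
    (differentiableAt_chartCurve hγ t).hasDerivAt
    (differentiableAt_chartField hV.1 t).hasDerivAt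
    (differentiableAt_chartField hW.1 t).hasDerivAt).congr_of_eventuallyEq
      (inner_eq_metricCoeff hγ t)
  convert! h using 1
  -- Each parallel equation is paired with the other field. In the sum the terms differentiating the
  -- metric along `V` and `W` cancel, leaving twice the product rule for the inner product.
  have e1 := (isParallelAlong_iff.1 hV).2 t (chartField γ W t t)
  have e2 := (isParallelAlong_iff.1 hW).2 t (chartField γ V t t)
  simp only [covariantPairing] at e1 e2
  simp only [metricCoeff_comm (γ t) _ (chartField γ W t t) (chartField γ V t t)] at e2
  rw [metricCoeff_comm (γ t) _ (deriv (chartField γ W t) t)] at e2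
  linarith

lemma IsParallelAlong.inner_eq (hV : IsParallelAlong γ V) (hW : IsParallelAlong γ W)
    (s t : ℝ) : inner ℝ (V s) (W s) = inner ℝ (V t) (W t) :=
  is_const_of_deriv_eq_zero (fun t => (hV.hasDerivAt_inner hW t).differentiableAt)
    (fun t => (hV.hasDerivAt_inner hW t).deriv) s t

lemma IsParallelAlong.norm_eq (hV : IsParallelAlong γ V) (s t : ℝ) : ‖V s‖ = ‖V t‖ := by
  rw [norm_eq_sqrt_real_inner, norm_eq_sqrt_real_inner, hV.inner_eq hV s t]

lemma IsParallelAlong.sub (hV : IsParallelAlong γ V) (hW : IsParallelAlong γ W) :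
    IsParallelAlong γ (fun t => V t - W t) := by
  simpa [sub_eq_add_neg] using hV.add (hW.smul (-1))

lemma IsParallelAlong.norm_sub_eq (hV : IsParallelAlong γ V) (hW : IsParallelAlong γ W)
    (s t : ℝ) : ‖V s - W s‖ = ‖V t - W t‖ :=
  (hV.sub hW).norm_eq s t

end ParallelFieldsAlongCurves

/-! ### Gradients and parallel transport along geodesics -/

section Geodesics

variable {E : Type*} [NormedAddCommGroup E] [NormedSpace ℝ E] [FiniteDimensional ℝ E]
  {M : Type*} [TopologicalSpace M] [ChartedSpace E M]
  [RiemannianBundle (fun x : M => TangentSpace 𝓘(ℝ, E) x)]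
  {γ : ℝ → M} {φ : M → ℝ} {L : ℝ}

instance finiteDimensional_tangentSpace (x : M) : FiniteDimensional ℝ (TangentSpace 𝓘(ℝ, E) x) :=
  inferInstanceAs (FiniteDimensional ℝ E)

instance completeSpace_tangentSpace (x : M) : CompleteSpace (TangentSpace 𝓘(ℝ, E) x) :=
  FiniteDimensional.complete ℝ _

lemma inner_grad (φ : M → ℝ) (x : M) (w : TangentSpace 𝓘(ℝ, E) x) :
    inner ℝ (grad φ x) w = mvfderiv 𝓘(ℝ, E) φ x w := by
  unfold grad
  exact InnerProductSpace.toDual_symm_apply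

lemma hasDerivAt_comp_curve (hφ : MDifferentiable 𝓘(ℝ, E) 𝓘(ℝ, ℝ) φ)
    (hγ : MDifferentiable 𝓘(ℝ, ℝ) 𝓘(ℝ, E) γ) (t : ℝ) :
    HasDerivAt (fun s => φ (γ s)) (inner ℝ (grad φ (γ t)) (velocity (E := E) γ t)) t := by
  rw [inner_grad]
  have h : HasFDerivAt (fun s => φ (γ s)) (show ℝ →L[ℝ] ℝ from
      (mfderiv 𝓘(ℝ, E) 𝓘(ℝ, ℝ) φ (γ t)).comp (mfderiv 𝓘(ℝ, ℝ) 𝓘(ℝ, E) γ t)) t :=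
    ((hφ (γ t)).hasMFDerivAt.comp t (hγ t).hasMFDerivAt).hasFDerivAt
  exact h.hasDerivAt

variable [IsManifold 𝓘(ℝ, E) ∞ M]

/-- The gradient of a geodesically smooth function at the initial point of a geodesic extends to
a parallel field. -/
lemma IsGeodesicallySmooth.exists_parallel (hφ : IsGeodesicallySmooth E L φ)
    (hγ : IsGeodesic (E := E) γ) :
    ∃ V : ∀ t, TangentSpace 𝓘(ℝ, E) (γ t), IsParallelAlong γ V ∧ V 0 = grad φ (γ 0) := by
  -- Smoothness extends the gradient at time 1, so it is applied to the reversed geodesic, which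
  -- ends at `γ 0`; a second reversal gives back `γ`.
  obtain ⟨w, ⟨V, hV, hV1, -⟩, -⟩ := hφ.2 _ (hγ.comp_affine (-1) 1)
  have hV1' : ∀ r : ℝ, r = 1 → V r = grad φ (γ (-1 * r + 1)) := by
    rintro r rfl
    exact hV1
  have e : (fun t => γ (-1 * (-1 * t + 1) + 1)) = γ := funext fun t => congrArg γ (by ring)
  have h : ∃ U : ∀ t, TangentSpace 𝓘(ℝ, E) ((fun t => γ (-1 * (-1 * t + 1) + 1)) t),
      IsParallelAlong (fun t => γ (-1 * (-1 * t + 1) + 1)) U ∧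
      U 0 = grad φ ((fun t => γ (-1 * (-1 * t + 1) + 1)) 0) :=
    ⟨_, hV.comp_affine (-1) 1, hV1' _ (by norm_num)⟩
  rwa [e] at h

variable [IsContMDiffRiemannianBundle 𝓘(ℝ, E) ∞ E (fun x : M => TangentSpace 𝓘(ℝ, E) x)]

/-- Smoothness is applied to `s ↦ γ (t * s)`, with initial velocity `t` times that of `γ`. Transport
back to time 0 preserves the inner product with the velocity, and Cauchy–Schwarz bounds the
difference of gradients. -/
lemma IsGeodesicallySmooth.inner_grad_velocity_le (hφ : IsGeodesicallySmooth E L φ)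
    (hγ : IsGeodesic (E := E) γ) {t : ℝ} (ht : 0 < t) :
    inner ℝ (grad φ (γ t)) (velocity (E := E) γ t) ≤
      inner ℝ (grad φ (γ 0)) (velocity (E := E) γ 0)
        + L * t * ‖velocity (E := E) γ 0‖ ^ 2 := by
  obtain ⟨w, ⟨V, hV, hV1, hV0⟩, hw⟩ := hφ.2 _ (hγ.comp_affine t 0)
  have hv := velocity_comp_affine hγ.mdifferentiable t 0
  have h := hV.inner_eq (hγ.comp_affine t 0) 1 0
  rw [hV1, hV0, hv, hv, real_inner_smul_right, real_inner_smul_right] at h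
  rw [hv, norm_smul, Real.norm_of_nonneg ht.le] at hw
  have hcs := real_inner_le_norm (w - grad φ (γ (t * 0 + 0))) (velocity (E := E) γ (t * 0 + 0))
  rw [norm_sub_rev, inner_sub_left] at hcs
  have h1 : inner ℝ (grad φ (γ (t * 1 + 0))) (velocity (E := E) γ (t * 1 + 0)) ≤
      inner ℝ (grad φ (γ (t * 0 + 0))) (velocity (E := E) γ (t * 0 + 0))
        + L * t * ‖velocity (E := E) γ (t * 0 + 0)‖ ^ 2 := by
    rw [mul_left_cancel₀ ht.ne' h]
    have := mul_le_mul_of_nonneg_right hw (norm_nonneg (velocity (E := E) γ (t * 0 + 0)))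
    nlinarith
  -- The times agree only propositionally and the tangent spaces depend on them; variables in their
  -- place avoid casts.
  have subst_times : ∀ r s : ℝ, r = t → s = 0 →
      inner ℝ (grad φ (γ r)) (velocity (E := E) γ r) ≤
        inner ℝ (grad φ (γ s)) (velocity (E := E) γ s) + L * t * ‖velocity (E := E) γ s‖ ^ 2 →
      inner ℝ (grad φ (γ t)) (velocity (E := E) γ t) ≤
        inner ℝ (grad φ (γ 0)) (velocity (E := E) γ 0)
          + L * t * ‖velocity (E := E) γ 0‖ ^ 2 := by
    rintro r s rfl rfl h
    exact h
  exact subst_times _ _ (by ring) (by ring) h1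

/-- The descent inequality along a geodesic. -/
lemma IsGeodesicallySmooth.le_along_geodesic (hφ : IsGeodesicallySmooth E L φ)
    (hγ : IsGeodesic (E := E) γ) :
    φ (γ 1) ≤ φ (γ 0) + inner ℝ (grad φ (γ 0)) (velocity (E := E) γ 0)
      + L / 2 * ‖velocity (E := E) γ 0‖ ^ 2 := by
  set A := inner ℝ (grad φ (γ 0)) (velocity (E := E) γ 0)
  set N := ‖velocity (E := E) γ 0‖ ^ 2
  -- Subtracting the integral of the bound `A + L * t * N` on the derivative leaves a function with
  -- nonpositive derivative; hence the factor `L / 2`.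
  have hd (t : ℝ) : HasDerivAt (fun s => φ (γ s) - (s * A + L / 2 * s ^ 2 * N))
      (inner ℝ (grad φ (γ t)) (velocity (E := E) γ t) - (A + L * t * N)) t := by
    refine (hasDerivAt_comp_curve hφ.1 hγ.mdifferentiable t).sub ?_
    have h1 := (hasDerivAt_id t).mul_const A
    have h2 := (((hasDerivAt_id t).pow 2).const_mul (L / 2)).mul_const N
    refine (h1.add h2).congr_deriv ?_
    simp only [id_eq, Nat.cast_ofNat, Nat.add_one_sub_one, pow_one]
    ring
  have hanti : AntitoneOn (fun s => φ (γ s) - (s * A + L / 2 * s ^ 2 * N)) (Set.Icc 0 1) := by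
    refine antitoneOn_of_deriv_nonpos (convex_Icc 0 1)
      (fun t _ => (hd t).continuousAt.continuousWithinAt)
      (fun t _ => (hd t).differentiableAt.differentiableWithinAt) fun t ht => ?_
    rw [interior_Icc] at ht
    rw [(hd t).deriv]
    have := hφ.inner_grad_velocity_le hγ ht.1
    linarith
  have := hanti (Set.left_mem_Icc.2 zero_le_one) (Set.right_mem_Icc.2 zero_le_one) zero_le_one
  simp only at this
  linarith

/-- Parallel transport along a geodesic extends to a linear contraction of tangent spaces. -/
lemma IsGeodesic.exists_transport_clm (hγ : IsGeodesic (E := E) γ) :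
    ∃ T : TangentSpace 𝓘(ℝ, E) (γ 0) →L[ℝ] TangentSpace 𝓘(ℝ, E) (γ 1),
      (∀ w, ‖T w‖ ≤ ‖w‖) ∧
      ∀ V : ∀ t, TangentSpace 𝓘(ℝ, E) (γ t), IsParallelAlong γ V → T (V 0) = V 1 := by
  let S : Submodule ℝ (TangentSpace 𝓘(ℝ, E) (γ 0)) :=
    { carrier := {w | ∃ V : ∀ t, TangentSpace 𝓘(ℝ, E) (γ t), IsParallelAlong γ V ∧ V 0 = w}
      add_mem' := by
        rintro _ _ ⟨V, hV, rfl⟩ ⟨W, hW, rfl⟩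
        exact ⟨_, hV.add hW, rfl⟩
      zero_mem' := ⟨_, IsParallelAlong.smul 0 hγ, zero_smul ℝ _⟩
      smul_mem' := by
        rintro c _ ⟨V, hV, rfl⟩
        exact ⟨_, hV.smul c, rfl⟩ }
  -- The difference of two parallel fields has constant norm, so vanishing at time 0 forces
  -- vanishing at time 1.
  have huniq : ∀ V W : ∀ t, TangentSpace 𝓘(ℝ, E) (γ t), IsParallelAlong γ V →
      IsParallelAlong γ W → V 0 = W 0 → V 1 = W 1 := by
    intro V W hV hW h
    have := hV.norm_sub_eq hW 1 0
    rwa [h, sub_self, norm_zero, norm_eq_zero, sub_eq_zero] at this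
  choose U hU hU0 using fun w : S => w.2
  let T₀ : S →ₗ[ℝ] TangentSpace 𝓘(ℝ, E) (γ 1) :=
    { toFun := fun w => U w 1
      map_add' := fun w w' => huniq _ _ (hU _) ((hU w).add (hU w')) (by
        rw [hU0, hU0, hU0, Submodule.coe_add])
      map_smul' := fun c w => huniq _ _ (hU _) ((hU w).smul c) (by
        rw [hU0, hU0, Submodule.coe_smul]) }
  have hT₀ (w : S) : ‖T₀ w‖ = ‖w‖ := by
    have := (hU w).norm_eq 1 0
    rw [hU0] at this
    exact this
  -- Extension by zero on the orthogonal complement of `S`: an isometry after a projection is a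
  -- contraction.
  refine ⟨(T₀.mkContinuous 1 fun w => by rw [hT₀, one_mul]).comp S.orthogonalProjectionOnto,
    fun w => ?_, fun V hV => ?_⟩
  · change ‖T₀ (S.orthogonalProjectionOnto w)‖ ≤ ‖w‖
    rw [hT₀]
    exact S.norm_orthogonalProjectionOnto_apply_le w
  · have hmem : V 0 ∈ S := ⟨V, hV, rfl⟩
    change T₀ (S.orthogonalProjectionOnto (V 0)) = V 1
    rw [show S.orthogonalProjectionOnto (V 0) = ⟨V 0, hmem⟩ from
      Submodule.orthogonalProjectionOnto_mem_subspace_eq_self (K := S) ⟨V 0, hmem⟩]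
    exact huniq _ _ (hU _) hV (hU0 _)

end Geodesics

/-! ### Transport and descent for the exponential map -/

section ExponentialMap

variable {E : Type*} [NormedAddCommGroup E] [NormedSpace ℝ E]
  {M : Type*} [TopologicalSpace M] [ChartedSpace E M] [IsManifold 𝓘(ℝ, E) ∞ M]
  [RiemannianBundle (fun x : M => TangentSpace 𝓘(ℝ, E) x)]
  {γ : ℝ → M} {φ : M → ℝ} {L : ℝ}

lemma GeodesicallyComplete.isGeodesicFrom (hM : GeodesicallyComplete E M)
    (v : TangentBundle 𝓘(ℝ, E) M) : IsGeodesicFrom v (geodesic v) := by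
  rw [geodesic, dif_pos (hM v)]
  exact (hM v).choose_spec

/-- `w` extends to a parallel field along `γ`, a curve which starts at the base point `x`
of `w`. -/
def IsTransportable (γ : ℝ → M) (x : M) (w : TangentSpace 𝓘(ℝ, E) x) : Prop :=
  ∃ V : ∀ t, TangentSpace 𝓘(ℝ, E) (γ t), IsParallelAlong γ V ∧
    (⟨γ 0, V 0⟩ : TangentBundle 𝓘(ℝ, E) M) = ⟨x, w⟩

lemma isTransportable_iff {w : TangentSpace 𝓘(ℝ, E) (γ 0)} :
    IsTransportable γ (γ 0) w ↔
      ∃ V : ∀ t, TangentSpace 𝓘(ℝ, E) (γ t), IsParallelAlong γ V ∧ V 0 = w := by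
  refine exists_congr fun V => and_congr_right fun _ => ⟨fun h => ?_, fun h => by rw [h]⟩
  exact TotalSpace.mk_injective (γ 0) h

/-- The velocity of a geodesic is parallel along it. This covers the estimator `g`, a multiple of
the step `-η g`. -/
lemma IsGeodesicFrom.isTransportable_smul {v : TangentBundle 𝓘(ℝ, E) M}
    (h : IsGeodesicFrom v γ) (c : ℝ) : IsTransportable γ v.proj (c • v.snd) := by
  obtain ⟨hγ, rfl⟩ := h
  exact isTransportable_iff.2 ⟨_, IsParallelAlong.smul c hγ, rfl⟩

variable [FiniteDimensional ℝ E]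
  [IsContMDiffRiemannianBundle 𝓘(ℝ, E) ∞ E (fun x : M => TangentSpace 𝓘(ℝ, E) x)]

lemma IsGeodesicFrom.isTransportable_smul_sum_grad {v : TangentBundle 𝓘(ℝ, E) M}
    (h : IsGeodesicFrom v γ) {ι : Type*} (s : Finset ι) {φ : ι → M → ℝ}
    (hφ : ∀ i, IsGeodesicallySmooth E L (φ i)) (c : ℝ) :
    IsTransportable γ v.proj (c • ∑ i ∈ s, grad (E := E) (φ i) v.proj) := by
  obtain ⟨hγ, rfl⟩ := h
  change IsTransportable γ (γ 0) (c • ∑ i ∈ s, grad (E := E) (φ i) (γ 0))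
  have hsum : ∃ V : ∀ t, TangentSpace 𝓘(ℝ, E) (γ t), IsParallelAlong γ V ∧
      V 0 = ∑ i ∈ s, grad (E := E) (φ i) (γ 0) := by
    classical
    induction s using Finset.induction_on with
    | empty => exact ⟨_, IsParallelAlong.smul 0 hγ, zero_smul ℝ _⟩
    | insert i s hi ih =>
      obtain ⟨V, hV, hV0⟩ := ih
      obtain ⟨W, hW, hW0⟩ := (hφ i).exists_parallel hγ
      exact ⟨_, hW.add hV, by rw [Finset.sum_insert hi, hV0, hW0]⟩
  obtain ⟨V, hV, hV0⟩ := hsum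
  exact isTransportable_iff.2 ⟨_, hV.smul c, by rw [hV0]⟩

/-- For a free curve `γ`, unlike for `geodesic v`, the vector `v` can be substituted by the initial
velocity, which identifies the two initial tangent spaces. -/
lemma IsGeodesicFrom.exists_transport_clm {v : TangentBundle 𝓘(ℝ, E) M}
    (h : IsGeodesicFrom v γ) :
    ∃ T : TangentSpace 𝓘(ℝ, E) v.proj →L[ℝ] TangentSpace 𝓘(ℝ, E) (γ 1),
      (∀ w, ‖T w‖ ≤ ‖w‖) ∧
      (∀ (V : ∀ t, TangentSpace 𝓘(ℝ, E) (γ t)) (w : TangentSpace 𝓘(ℝ, E) v.proj),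
        IsParallelAlong γ V → (⟨γ 0, V 0⟩ : TangentBundle 𝓘(ℝ, E) M) = ⟨v.proj, w⟩ →
        T w = V 1) ∧
      ∀ (L : ℝ) (φ : M → ℝ), IsGeodesicallySmooth E L φ →
        ‖grad φ (γ 1) - T (grad φ v.proj)‖ ≤ L * ‖v.snd‖ := by
  obtain ⟨hγ, rfl⟩ := h
  obtain ⟨T, hT, hTV⟩ := hγ.exists_transport_clm
  refine ⟨T, hT, fun V w hV hVw => ?_, fun L φ hφ => ?_⟩
  · rw [← hTV V hV]
    exact congrArg T (TotalSpace.mk_injective (γ 0) hVw).symm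
  · obtain ⟨w, ⟨V, hV, hV1, hV0⟩, hw⟩ := hφ.2 γ hγ
    obtain ⟨W, hW, hW0⟩ := hφ.exists_parallel hγ
    change ‖grad φ (γ 1) - T (grad φ (γ 0))‖ ≤ L * ‖velocity (E := E) γ 0‖
    rw [← hW0, hTV W hW, ← hV1, hV.norm_sub_eq hW 1 0, norm_sub_rev, hV0, hW0]
    exact hw

/-- On the vectors which can be transported along `t ↦ Exp (t v)`, parallel transport agrees with
a linear contraction, which moves the gradients of geodesically smooth functions as expected. -/
lemma GeodesicallyComplete.exists_transport_clm (hM : GeodesicallyComplete E M)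
    (v : TangentBundle 𝓘(ℝ, E) M) :
    ∃ T : TangentSpace 𝓘(ℝ, E) v.proj →L[ℝ] TangentSpace 𝓘(ℝ, E) (expMap v),
      (∀ w, ‖T w‖ ≤ ‖w‖) ∧
      (∀ w, IsTransportable (geodesic v) v.proj w → transport v w = T w) ∧
      ∀ (L : ℝ) (φ : M → ℝ), IsGeodesicallySmooth E L φ →
        ‖grad φ (expMap v) - T (grad φ v.proj)‖ ≤ L * ‖v.snd‖ := by
  obtain ⟨T, hT, hTV, hTg⟩ := (hM.isGeodesicFrom v).exists_transport_clm
  refine ⟨T, hT, fun w hw => ?_, hTg⟩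
  exact (dif_pos hw).trans (hTV _ w hw.choose_spec.1 hw.choose_spec.2).symm

/-- The descent inequality for geodesically smooth functions. -/
lemma IsGeodesicallySmooth.le_expMap (hM : GeodesicallyComplete E M)
    (hφ : IsGeodesicallySmooth E L φ) (v : TangentBundle 𝓘(ℝ, E) M) :
    φ (expMap v) ≤ φ v.proj + inner ℝ (grad φ v.proj) v.snd + L / 2 * ‖v.snd‖ ^ 2 := by
  have key : ∀ γ : ℝ → M, IsGeodesicFrom v γ →
      φ (γ 1) ≤ φ v.proj + inner ℝ (grad φ v.proj) v.snd + L / 2 * ‖v.snd‖ ^ 2 := by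
    rintro γ ⟨hγ, rfl⟩
    exact hφ.le_along_geodesic hγ
  exact key _ (hM.isGeodesicFrom v)

/-- The descent inequality for an expectation of geodesically smooth functions. -/
lemma integral_le_expMap (hM : GeodesicallyComplete E M) {Ξ : Type*} [MeasurableSpace Ξ]
    {D : Measure Ξ} [IsProbabilityMeasure D] {F : M → Ξ → ℝ} {f : M → ℝ}
    (hF : ∀ x, Integrable (F x) D) (hf : ∀ x, f x = ∫ ξ, F x ξ ∂D)
    (hsmooth : ∀ ξ, IsGeodesicallySmooth E L (fun x => F x ξ))
    (hint : ∀ x, Integrable (fun ξ => grad (E := E) (fun y => F y ξ) x) D)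
    (hunb : ∀ x, ∫ ξ, grad (E := E) (fun y => F y ξ) x ∂D = grad f x)
    (v : TangentBundle 𝓘(ℝ, E) M) :
    f (expMap v) ≤ f v.proj + inner ℝ (grad f v.proj) v.snd + L / 2 * ‖v.snd‖ ^ 2 := by
  have hin : Integrable (fun ξ => inner ℝ (grad (E := E) (fun y => F y ξ) v.proj) v.snd) D :=
    (hint v.proj).inner_const v.snd
  have h1 : ∫ ξ, inner ℝ (grad (E := E) (fun y => F y ξ) v.proj) v.snd ∂D
      = inner ℝ (grad f v.proj) v.snd := by
    rw [← hunb]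
    simp_rw [real_inner_comm v.snd]
    exact integral_inner (hint v.proj) v.snd
  -- Averaging the descent inequalities of the samples avoids transporting ∇f.
  calc f (expMap v) = ∫ ξ, F (expMap v) ξ ∂D := hf _
    _ ≤ ∫ ξ, (F v.proj ξ + inner ℝ (grad (E := E) (fun y => F y ξ) v.proj) v.snd
          + L / 2 * ‖v.snd‖ ^ 2) ∂D :=
        integral_mono (hF _) (((hF _).add hin).add (integrable_const _))
          fun ξ => (hsmooth ξ).le_expMap hM v
    _ = _ := by
        have h2 := (hF v.proj).add hin
        have h3 : ∫ ξ, (F v.proj ξ + inner ℝ (grad (E := E) (fun y => F y ξ) v.proj) v.snd) ∂D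
            = f v.proj + inner ℝ (grad f v.proj) v.snd := by
          rw [integral_add (hF _) hin, h1, ← hf]
        rw [integral_add (f := fun ξ => F v.proj ξ
          + inner ℝ (grad (E := E) (fun y => F y ξ) v.proj) v.snd) h2 (integrable_const _), h3,
          integral_const]
        simp

end ExponentialMap

/-! ### Second moments of minibatch means -/

section Variance

variable {Ξ : Type*} [MeasurableSpace Ξ]

/-- For a non-measurable integrand the product integral is still at most the iterated one, the
direction used throughout. -/
lemma lintegral_pi_succ_le (μ : Measure Ξ) [SigmaFinite μ] {n : ℕ}
    (h : (Fin (n + 1) → Ξ) → ENNReal) :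
    ∫⁻ ξ, h ξ ∂(Measure.pi fun _ => μ) ≤
      ∫⁻ a, ∫⁻ ξ, h (Fin.cons a ξ) ∂(Measure.pi fun _ => μ) ∂μ := by
  have e := (measurePreserving_piFinSuccAbove (fun _ : Fin (n + 1) => μ) 0).symm
  rw [e.lintegral_map_equiv h]
  refine (lintegral_prod_le _).trans (le_of_eq ?_)
  simp only [MeasurableEquiv.piFinSuccAbove_symm_apply, Fin.insertNthEquiv_zero]
  rfl

lemma enorm_sq_eq_ofReal {H : Type*} [SeminormedAddGroup H] (x : H) :
    ‖x‖ₑ ^ 2 = ENNReal.ofReal (‖x‖ ^ 2) := by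
  rw [ENNReal.ofReal_pow (norm_nonneg x), ofReal_norm]

/-- Cauchy–Schwarz against the constant 1, applied to a measurable minorant with the same lower
integral. -/
lemma lintegral_le_of_lintegral_sq_le {μ : Measure Ξ} [IsProbabilityMeasure μ]
    {h : Ξ → ENNReal} {ε : ℝ} (hε : 0 < ε)
    (hsq : ∫⁻ ξ, h ξ ^ 2 ∂μ ≤ ENNReal.ofReal (ε ^ 2)) :
    ∫⁻ ξ, h ξ ∂μ ≤ ENNReal.ofReal ε := by
  obtain ⟨k, hk, hkh, hk_eq⟩ := exists_measurable_le_lintegral_eq μ h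
  have hkk : ∫⁻ ξ, k ξ ^ (2 : ℝ) ∂μ ≤ ENNReal.ofReal ε ^ (2 : ℝ) := by
    rw [ENNReal.ofReal_rpow_of_pos hε]
    simp only [ENNReal.rpow_two, Real.rpow_two]
    exact (lintegral_mono fun ξ => pow_le_pow_left' (hkh ξ) 2).trans hsq
  have h1 := ENNReal.lintegral_mul_le_Lp_mul_Lq μ Real.HolderConjugate.two_two
    hk.aemeasurable (aemeasurable_const (b := (1 : ENNReal)))
  rw [hk_eq]
  simp only [Pi.mul_apply, mul_one, ENNReal.one_rpow, lintegral_const, measure_univ] at h1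
  refine h1.trans ((ENNReal.rpow_le_rpow hkk (by norm_num)).trans (le_of_eq ?_))
  rw [← ENNReal.rpow_mul]
  norm_num

variable {H : Type*} [NormedAddCommGroup H] [InnerProductSpace ℝ H] [CompleteSpace H]
  {μ : Measure Ξ} [IsProbabilityMeasure μ] {Y : Ξ → H}

lemma lintegral_enorm_add_sq_le (hY : Integrable Y μ) (hY0 : ∫ ξ, Y ξ ∂μ = 0) {v : ENNReal}
    (hv : ∫⁻ ξ, ‖Y ξ‖ₑ ^ 2 ∂μ ≤ v) (w : H) :
    ∫⁻ ξ, ‖w + Y ξ‖ₑ ^ 2 ∂μ ≤ ‖w‖ₑ ^ 2 + v := by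
  -- An infinite second moment makes the bound trivial; otherwise the square can be expanded, and
  -- its cross term has mean zero.
  by_cases htop : ∫⁻ ξ, ‖Y ξ‖ₑ ^ 2 ∂μ = ⊤
  · rw [htop, top_le_iff] at hv
    simp [hv]
  have hsq : Integrable (fun ξ => ‖Y ξ‖ ^ 2) μ := by
    refine ⟨hY.1.norm.pow 2, ?_⟩
    rw [hasFiniteIntegral_iff_enorm]
    simpa [enorm_pow, lt_top_iff_ne_top] using htop
  have hin : Integrable (fun ξ => inner ℝ w (Y ξ)) μ := hY.const_inner w
  have hin0 : ∫ ξ, inner ℝ w (Y ξ) ∂μ = 0 := by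
    rw [integral_inner hY, hY0, inner_zero_right]
  have hexp (ξ : Ξ) : ‖w + Y ξ‖ ^ 2 = ‖w‖ ^ 2 + 2 * inner ℝ w (Y ξ) + ‖Y ξ‖ ^ 2 :=
    norm_add_sq_real w (Y ξ)
  have hI : Integrable (fun ξ => ‖w‖ ^ 2 + 2 * inner ℝ w (Y ξ)) μ :=
    (integrable_const _).add (hin.const_mul 2)
  refine le_trans ?_ (add_le_add_right hv _)
  simp_rw [enorm_sq_eq_ofReal, hexp]
  rw [← ofReal_integral_eq_lintegral_ofReal
      (f := fun ξ => ‖w‖ ^ 2 + 2 * inner ℝ w (Y ξ) + ‖Y ξ‖ ^ 2) (hI.add hsq)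
      (.of_forall fun ξ => by simp only [Pi.zero_apply]; rw [← hexp]; positivity),
    ← ofReal_integral_eq_lintegral_ofReal hsq (.of_forall fun ξ => by positivity),
    ← ENNReal.ofReal_add (by positivity) (integral_nonneg fun ξ => by positivity),
    integral_add hI hsq, integral_add (integrable_const _) (hin.const_mul 2),
    integral_const_mul, hin0]
  simp

/-- Variance is at most the second moment: bounding ‖Z‖ by `R` before integrating leaves R² - ‖c‖².
-/
lemma lintegral_enorm_sub_integral_sq_le {Z : Ξ → H} (hZ : Integrable Z μ) {R : ℝ}
    (hR : ∀ ξ, ‖Z ξ‖ ≤ R) :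
    ∫⁻ ξ, ‖Z ξ - ∫ ζ, Z ζ ∂μ‖ₑ ^ 2 ∂μ ≤ ENNReal.ofReal (R ^ 2) := by
  set c := ∫ ζ, Z ζ ∂μ
  have hle (ξ : Ξ) : ‖Z ξ - c‖ ^ 2 ≤ R ^ 2 + ‖c‖ ^ 2 - 2 * inner ℝ c (Z ξ) := by
    rw [norm_sub_sq_real, real_inner_comm]
    have := pow_le_pow_left₀ (norm_nonneg _) (hR ξ) 2
    linarith
  have hin : Integrable (fun ξ => 2 * inner ℝ c (Z ξ)) μ := (hZ.const_inner c).const_mul 2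
  simp_rw [enorm_sq_eq_ofReal]
  refine (lintegral_mono fun ξ => ENNReal.ofReal_le_ofReal (hle ξ)).trans ?_
  rw [← ofReal_integral_eq_lintegral_ofReal
      (f := fun ξ => R ^ 2 + ‖c‖ ^ 2 - 2 * inner ℝ c (Z ξ)) ((integrable_const _).sub hin)
      (.of_forall fun ξ => (sq_nonneg _).trans (hle ξ)),
    integral_sub (integrable_const _) hin, integral_const_mul, integral_inner hZ,
    real_inner_self_eq_norm_sq]
  refine ENNReal.ofReal_le_ofReal ?_
  simp only [integral_const, probReal_univ, one_smul]
  nlinarith [sq_nonneg ‖c‖]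

/-- The shift `w` is arbitrary so that the induction can absorb the first sample into it. -/
lemma lintegral_pi_enorm_add_sum_sq_le (hY : Integrable Y μ) (hY0 : ∫ ξ, Y ξ ∂μ = 0)
    {v : ENNReal} (hv : ∫⁻ ξ, ‖Y ξ‖ₑ ^ 2 ∂μ ≤ v) (m : ℕ) (w : H) :
    ∫⁻ ξ : Fin m → Ξ, ‖w + ∑ i, Y (ξ i)‖ₑ ^ 2 ∂(Measure.pi fun _ => μ) ≤ ‖w‖ₑ ^ 2 + m * v := by
  induction m generalizing w with
  | zero => simp
  | succ m ih =>
    refine (lintegral_pi_succ_le μ _).trans ?_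
    calc ∫⁻ a, ∫⁻ ξ : Fin m → Ξ, ‖w + ∑ i, Y ((Fin.cons a ξ : Fin (m + 1) → Ξ) i)‖ₑ ^ 2
          ∂(Measure.pi fun _ => μ) ∂μ
        ≤ ∫⁻ a, (‖w + Y a‖ₑ ^ 2 + m * v) ∂μ := by
          refine lintegral_mono fun a => ?_
          simp only [Fin.sum_univ_succ, Fin.cons_zero, Fin.cons_succ, ← add_assoc]
          exact ih _
      _ = ∫⁻ a, ‖w + Y a‖ₑ ^ 2 ∂μ + m * v := by
          rw [lintegral_add_right _ measurable_const, lintegral_const, measure_univ, mul_one]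
      _ ≤ ‖w‖ₑ ^ 2 + v + m * v := add_le_add_left (lintegral_enorm_add_sq_le hY hY0 hv w) _
      _ = ‖w‖ₑ ^ 2 + (m + 1 : ℕ) * v := by push_cast; ring

/-- The second moment of a shifted empirical mean of centred samples. -/
lemma lintegral_pi_enorm_add_mean_sq_le (hY : Integrable Y μ) (hY0 : ∫ ξ, Y ξ ∂μ = 0)
    {v : ℝ} (hv : ∫⁻ ξ, ‖Y ξ‖ₑ ^ 2 ∂μ ≤ ENNReal.ofReal v) {m : ℕ} (hm : 0 < m) (w : H) :
    ∫⁻ ξ : Fin m → Ξ, ‖w + (m : ℝ)⁻¹ • ∑ i, Y (ξ i)‖ₑ ^ 2 ∂(Measure.pi fun _ => μ)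
      ≤ ‖w‖ₑ ^ 2 + ENNReal.ofReal (v / m) := by
  have hm' : (0 : ℝ) < m := Nat.cast_pos.2 hm
  have h := lintegral_pi_enorm_add_sum_sq_le (Y := fun ξ => (m : ℝ)⁻¹ • Y ξ) (μ := μ)
    (hY.smul _) (by rw [integral_smul, hY0, smul_zero])
    (v := ENNReal.ofReal (((m : ℝ)⁻¹) ^ 2 * v)) (by
      have e (ξ : Ξ) : ‖(m : ℝ)⁻¹ • Y ξ‖ₑ ^ 2
          = ENNReal.ofReal (((m : ℝ)⁻¹) ^ 2) * ‖Y ξ‖ₑ ^ 2 := by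
        rw [enorm_smul, mul_pow, enorm_sq_eq_ofReal, Real.norm_eq_abs, sq_abs]
      simp_rw [e]
      rw [lintegral_const_mul' _ _ ENNReal.ofReal_ne_top, ENNReal.ofReal_mul (by positivity)]
      gcongr) m w
  simp_rw [← Finset.smul_sum] at h
  refine h.trans (le_of_eq ?_)
  rw [← ENNReal.ofReal_natCast, ← ENNReal.ofReal_mul hm'.le]
  congr 2
  field_simp

end Variance

/-! ### Summation along random orbits -/

section Orbits

variable {α S : Type*}

/-- The orbit of `z` under a map driven by the inputs `s 0, s 1, …`. -/
def orbit (T : α → S → α) (z : α) {K : ℕ} (s : Fin K → S) : Fin (K + 1) → α :=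
  Fin.induction (motive := fun _ => α) z (fun k w => T w (s k))

/-- Moving the first input into the starting point lets induction on the length integrate over that
input last, with no regularity of `T`. -/
lemma orbit_cons_succ (T : α → S → α) (z : α) {K : ℕ} (a : S) (s : Fin K → S) (i : Fin (K + 1)) :
    orbit T z (Fin.cons a s : Fin (K + 1) → S) i.succ = orbit T (T z a) s i := by
  induction i using Fin.induction with
  | zero => rfl
  | succ j ih =>
    have h1 : orbit T z (Fin.cons a s : Fin (K + 1) → S) j.succ.succ
        = T (orbit T z (Fin.cons a s : Fin (K + 1) → S) j.castSucc.succ) (s j) := rfl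
    rw [h1, ih]
    rfl

variable [MeasurableSpace S]

/-- Summation of a supermartingale-type inequality along a random orbit. -/
lemma lintegral_pi_sum_orbit_le (ν : Measure S) [IsProbabilityMeasure ν] (T : α → S → α)
    (h Φ : α → ENNReal) (C : ENNReal)
    (hstep : ∀ z, h z + ∫⁻ s, Φ (T z s) ∂ν ≤ Φ z + C) (K : ℕ) (z : α) :
    ∫⁻ s : Fin K → S, ∑ i : Fin K, h (orbit T z s i.castSucc) ∂(Measure.pi fun _ => ν)
      ≤ Φ z + K * C := by
  induction K generalizing z with
  | zero => simp
  | succ K ih =>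
    refine (lintegral_pi_succ_le ν _).trans ?_
    have e (a : S) (s : Fin K → S) :
        ∑ i : Fin (K + 1), h (orbit T z (Fin.cons a s : Fin (K + 1) → S) i.castSucc)
          = h z + ∑ i : Fin K, h (orbit T (T z a) s i.castSucc) := by
      rw [Fin.sum_univ_succ]
      congr 1
      refine Finset.sum_congr rfl fun i _ => ?_
      rw [← orbit_cons_succ]
      rfl
    simp_rw [e]
    calc ∫⁻ a, ∫⁻ s : Fin K → S, h z + ∑ i : Fin K, h (orbit T (T z a) s i.castSucc)
          ∂(Measure.pi fun _ => ν) ∂ν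
        ≤ ∫⁻ a, (h z + K * C) + Φ (T z a) ∂ν := by
          refine lintegral_mono fun a => ?_
          rw [lintegral_add_left measurable_const, lintegral_const, measure_univ, mul_one,
            add_assoc, add_comm (K * C)]
          gcongr
          exact ih _
      _ = K * C + (h z + ∫⁻ a, Φ (T z a) ∂ν) := by
          rw [lintegral_add_left measurable_const, lintegral_const, measure_univ, mul_one]
          ring
      _ ≤ K * C + (Φ z + C) := add_le_add_right (hstep z) _
      _ = Φ z + (K + 1 : ℕ) * C := by push_cast; ring

/-- Lower integrals are superadditive without measurability. -/
lemma sum_lintegral_le_lintegral_sum {ι : Type*} (μ : Measure S) (t : Finset ι)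
    (h : ι → S → ENNReal) :
    ∑ i ∈ t, ∫⁻ s, h i s ∂μ ≤ ∫⁻ s, ∑ i ∈ t, h i s ∂μ := by
  classical
  induction t using Finset.induction_on with
  | empty => simp
  | insert i t hi ih =>
    simp_rw [Finset.sum_insert hi]
    exact (add_le_add_right ih _).trans (le_lintegral_add _ _)

/-- The mean over a uniformly random index is at most the mean of the sum. -/
lemma lintegral_uniformOn_prod_le (μ : Measure S) [SFinite μ] (K : ℕ)
    (h : Fin K → S → ENNReal) :
    ∫⁻ q : Fin K × S, h q.1 q.2 ∂((ProbabilityTheory.uniformOn Set.univ).prod μ)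
      ≤ (K : ENNReal)⁻¹ * ∫⁻ s, ∑ i, h i s ∂μ := by
  refine (lintegral_prod_le _).trans ?_
  rw [ProbabilityTheory.uniformOn, ProbabilityTheory.cond, lintegral_smul_measure,
    Measure.restrict_univ, lintegral_count, tsum_fintype, Measure.count_univ, smul_eq_mul]
  simp only [ENat.card_eq_coe_fintype_card, Fintype.card_fin, ENat.toENNReal_coe]
  gcongr
  exact sum_lintegral_le_lintegral_sum μ _ _

end Orbits

/-! ### The law of one step and the expected cost -/

section StepLaw

variable {Ξ : Type*} [MeasurableSpace Ξ] {D : Measure Ξ} [IsProbabilityMeasure D]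
  {B b K : ℕ} {p : ℝ}

lemma isProbabilityMeasure_coin (h0 : 0 ≤ p) (h1 : p ≤ 1) :
    IsProbabilityMeasure (ENNReal.ofReal p • Measure.dirac true
      + ENNReal.ofReal (1 - p) • Measure.dirac false : Measure Bool) := by
  constructor
  simp only [Measure.add_apply, Measure.smul_apply, measure_univ, smul_eq_mul, mul_one]
  rw [← ENNReal.ofReal_add h0 (by linarith)]
  simp

lemma isProbabilityMeasure_stepLaw (h0 : 0 ≤ p) (h1 : p ≤ 1) :
    IsProbabilityMeasure (stepLaw D B b p) := by
  have := isProbabilityMeasure_coin h0 h1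
  unfold stepLaw
  infer_instance

/-- Each side of the coin uses one minibatch; the other integrates out with mass one. -/
lemma lintegral_stepLaw_le (h : StepSample Ξ B b → ENNReal)
    (h₁ : (Fin B → Ξ) → ENNReal) (h₂ : (Fin b → Ξ) → ENNReal)
    (ht : ∀ ζ ξ, h (true, ζ, ξ) = h₁ ζ) (hf : ∀ ζ ξ, h (false, ζ, ξ) = h₂ ξ) :
    ∫⁻ s, h s ∂(stepLaw D B b p) ≤
      ENNReal.ofReal p * ∫⁻ ζ, h₁ ζ ∂(Measure.pi fun _ => D)
        + ENNReal.ofReal (1 - p) * ∫⁻ ξ, h₂ ξ ∂(Measure.pi fun _ => D) := by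
  refine (lintegral_prod_le _).trans ?_
  rw [lintegral_add_measure, lintegral_smul_measure, lintegral_smul_measure, lintegral_dirac,
    lintegral_dirac, smul_eq_mul, smul_eq_mul]
  gcongr
  · refine (lintegral_prod_le _).trans (le_of_eq ?_)
    simp [ht]
  · refine (lintegral_prod_le _).trans (le_of_eq ?_)
    simp [hf]

lemma lintegral_gradCount_le (h0 : 0 ≤ p) (h1 : p ≤ 1) :
    ∫⁻ r, (gradCount r : ENNReal) ∂(runLaw D B b p K) ≤
      ENNReal.ofReal (B + K * (p * B + (1 - p) * (2 * b))) := by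
  have := isProbabilityMeasure_stepLaw (D := D) (B := B) (b := b) h0 h1
  have hstep : ∫⁻ s, (if s.1 = true then (B : ENNReal) else 2 * b) ∂(stepLaw D B b p)
      ≤ ENNReal.ofReal (p * B + (1 - p) * (2 * b)) := by
    refine (lintegral_stepLaw_le _ (fun _ => (B : ENNReal)) (fun _ => 2 * b)
      (by simp) (by simp)).trans (le_of_eq ?_)
    have h1' : 0 ≤ 1 - p := by linarith
    rw [ENNReal.ofReal_add (by positivity) (by positivity), ENNReal.ofReal_mul h0,
      ENNReal.ofReal_mul h1', ENNReal.ofReal_mul zero_le_two]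
    simp
  have hmeas : Measurable fun s : StepSample Ξ B b =>
      if s.1 = true then (B : ENNReal) else 2 * b :=
    Measurable.ite (measurable_fst (measurableSet_singleton true)) measurable_const
      measurable_const
  have hmeas_eval (k : Fin K) : Measurable fun s : Fin K → StepSample Ξ B b =>
      if (s k).1 = true then (B : ENNReal) else 2 * b := hmeas.comp (measurable_pi_apply k)
  refine (lintegral_prod_le _).trans ?_
  have hcount (ζ : Fin B → Ξ) (s : Fin K → StepSample Ξ B b) : (gradCount (ζ, s) : ENNReal)
      = B + ∑ k, if (s k).1 = true then (B : ENNReal) else 2 * b := by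
    simp [gradCount]
  simp_rw [hcount]
  rw [lintegral_const, measure_univ, mul_one, lintegral_add_left measurable_const,
    lintegral_finsetSum _ fun k _ => hmeas_eval k,
    lintegral_const, measure_univ, mul_one, ENNReal.ofReal_add (by positivity) (by
      have : 0 ≤ 1 - p := by linarith
      positivity), ENNReal.ofReal_natCast, ENNReal.ofReal_mul (by positivity),
    ENNReal.ofReal_natCast]
  gcongr
  calc _ ≤ ∑ _k : Fin K, ENNReal.ofReal (p * B + (1 - p) * (2 * b)) := by
        refine Finset.sum_le_sum fun k _ => ?_
        rw [(measurePreserving_eval (fun _ : Fin K => stepLaw D B b p) k).lintegral_comp hmeas]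
        exact hstep
    _ = _ := by simp

end StepLaw

lemma inv_smul_sum_sub {H : Type*} [AddCommGroup H] [Module ℝ H] {m : ℕ} (hm : 0 < m)
    (a : Fin m → H) (c : H) :
    (m : ℝ)⁻¹ • ∑ i, (a i - c) = (m : ℝ)⁻¹ • ∑ i, a i - c := by
  have hm' : (m : ℝ) ≠ 0 := Nat.cast_ne_zero.2 hm.ne'
  rw [Finset.sum_sub_distrib, smul_sub, Finset.sum_const, Finset.card_univ, Fintype.card_fin,
    ← Nat.cast_smul_eq_nsmul ℝ, smul_smul, inv_mul_cancel₀ hm', one_smul]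

/-! ### Estimator error and Lyapunov decrease -/

section Convergence

variable {E : Type*} [NormedAddCommGroup E] [NormedSpace ℝ E] [FiniteDimensional ℝ E]
  {M : Type*} [TopologicalSpace M] [ChartedSpace E M]
  [RiemannianBundle (fun x : M => TangentSpace 𝓘(ℝ, E) x)]
  {Ξ : Type*} [MeasurableSpace Ξ] {D : Measure Ξ} [IsProbabilityMeasure D]
  {F : M → Ξ → ℝ} {f : M → ℝ} {L σ η p c fstar : ℝ} {B b : ℕ}

lemma lintegral_batchGrad_sub_grad_le
    (hint : ∀ x, Integrable (fun ξ => grad (E := E) (fun y => F y ξ) x) D)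
    (hunb : ∀ x, ∫ ξ, grad (E := E) (fun y => F y ξ) x ∂D = grad f x)
    (hvar : ∀ x, ∫⁻ ξ, ‖grad (E := E) (fun y => F y ξ) x - grad f x‖ₑ ^ 2 ∂D
      ≤ ENNReal.ofReal (σ ^ 2)) (hB : 0 < B) (x : M) :
    ∫⁻ ζ : Fin B → Ξ, ‖batchGrad E F ζ x - grad f x‖ₑ ^ 2 ∂(Measure.pi fun _ => D)
      ≤ ENNReal.ofReal (σ ^ 2 / B) := by
  have h := lintegral_pi_enorm_add_mean_sq_le
    (Y := fun ξ => grad (E := E) (fun y => F y ξ) x - grad f x) (μ := D)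
    ((hint x).sub (integrable_const _))
    (by rw [integral_sub (hint x) (integrable_const _), hunb, integral_const]; simp)
    (hvar x) hB 0
  simp only [inv_smul_sum_sub hB, zero_add, enorm_zero, ne_eq, OfNat.ofNat_ne_zero,
    not_false_eq_true, zero_pow] at h
  exact h

variable [IsManifold 𝓘(ℝ, E) ∞ M]
  [IsContMDiffRiemannianBundle 𝓘(ℝ, E) ∞ E (fun x : M => TangentSpace 𝓘(ℝ, E) x)]

/-- The error of the recursive gradient estimator. -/
lemma lintegral_recursive_estimator_le (hM : GeodesicallyComplete E M)
    (hsmooth : ∀ ξ, IsGeodesicallySmooth E L (fun x => F x ξ))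
    (hint : ∀ x, Integrable (fun ξ => grad (E := E) (fun y => F y ξ) x) D)
    (hunb : ∀ x, ∫ ξ, grad (E := E) (fun y => F y ξ) x ∂D = grad f x)
    (hb : 0 < b) (v : TangentBundle 𝓘(ℝ, E) M) (g : TangentSpace 𝓘(ℝ, E) v.proj) (c : ℝ)
    (hg : g = c • v.snd) :
    ∫⁻ ξ : Fin b → Ξ, ‖transport v g + batchGrad E F ξ (expMap v)
        - transport v (batchGrad E F ξ v.proj) - grad f (expMap v)‖ₑ ^ 2
        ∂(Measure.pi fun _ => D)
      ≤ ‖g - grad f v.proj‖ₑ ^ 2 + ENNReal.ofReal ((L * ‖v.snd‖) ^ 2 / b) := by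
  obtain ⟨T, hT, hTw, hTg⟩ := hM.exists_transport_clm v
  have hγ := hM.isGeodesicFrom v
  have hTint : Integrable (fun ξ => T (grad (E := E) (fun y => F y ξ) v.proj)) D :=
    T.integrable_comp (hint v.proj)
  have hmean : ∫ ξ, (grad (E := E) (fun y => F y ξ) (expMap v)
      - T (grad (E := E) (fun y => F y ξ) v.proj)) ∂D
        = grad f (expMap v) - T (grad f v.proj) := by
    rw [integral_sub (hint _) hTint, T.integral_comp_comm (hint _), hunb, hunb]
  -- The new error is `T` of the old error plus a mean of centred differences ∇F(y, ξ) - T ∇F(x, ξ),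
  -- each bounded by L‖v‖ before centring.
  have hZ := (hint (expMap v)).sub hTint
  have hvar := lintegral_enorm_sub_integral_sq_le hZ fun ξ => hTg L _ (hsmooth ξ)
  simp only [Pi.sub_apply, hmean] at hvar
  have h := lintegral_pi_enorm_add_mean_sq_le
    (Y := fun ξ => (grad (E := E) (fun y => F y ξ) (expMap v)
      - T (grad (E := E) (fun y => F y ξ) v.proj)) - (grad f (expMap v) - T (grad f v.proj)))
    (μ := D) (hZ.sub (integrable_const _))
    (by
      rw [integral_sub (f := fun ξ => grad (E := E) (fun y => F y ξ) (expMap v)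
        - T (grad (E := E) (fun y => F y ξ) v.proj)) hZ (integrable_const _)]
      simp only [hmean, integral_const, probReal_univ, one_smul, sub_self])
    hvar hb (T (g - grad f v.proj))
  refine le_trans (le_of_eq ?_) (h.trans ?_)
  · refine lintegral_congr fun ξ => ?_
    congr 2
    have h1 : transport v (batchGrad E F ξ v.proj) = T (batchGrad E F ξ v.proj) :=
      hTw _ (hγ.isTransportable_smul_sum_grad Finset.univ (fun i => hsmooth (ξ i)) _)
    have h2 : transport v g = T g := hTw _ (hg ▸ hγ.isTransportable_smul c)
    rw [h1, h2, inv_smul_sum_sub hb, Finset.sum_sub_distrib, smul_sub, ← map_sum, ← map_smul,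
      map_sub]
    simp only [batchGrad]
    abel
  · gcongr
    rw [← ofReal_norm, ← ofReal_norm]
    exact ENNReal.ofReal_le_ofReal (hT _)

/-- The Lyapunov function of the method. -/
def lyapunov (f : M → ℝ) (fstar c : ℝ) (z : TangentBundle 𝓘(ℝ, E) M) : ENNReal :=
  ENNReal.ofReal (f z.proj - fstar) + ENNReal.ofReal c * ‖z.snd - grad f z.proj‖ₑ ^ 2

/-- Given `z`, the next point is deterministic, so only the estimator error is averaged over the
coin. -/
lemma lintegral_lyapunov_step_le (hM : GeodesicallyComplete E M)
    (hsmooth : ∀ ξ, IsGeodesicallySmooth E L (fun x => F x ξ))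
    (hint : ∀ x, Integrable (fun ξ => grad (E := E) (fun y => F y ξ) x) D)
    (hunb : ∀ x, ∫ ξ, grad (E := E) (fun y => F y ξ) x ∂D = grad f x)
    (hvar : ∀ x, ∫⁻ ξ, ‖grad (E := E) (fun y => F y ξ) x - grad f x‖ₑ ^ 2 ∂D
      ≤ ENNReal.ofReal (σ ^ 2))
    (hB : 0 < B) (hb : 0 < b) (hη : 0 < η) (hp0 : 0 ≤ p) (hp1 : p ≤ 1)
    (z : TangentBundle 𝓘(ℝ, E) M) :
    ∫⁻ s : StepSample Ξ B b, lyapunov f fstar c (step F η z s) ∂(stepLaw D B b p) ≤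
      ENNReal.ofReal (f (expMap ⟨z.proj, -(η • z.snd)⟩) - fstar)
        + ENNReal.ofReal c * (ENNReal.ofReal p * ENNReal.ofReal (σ ^ 2 / B)
          + ENNReal.ofReal (1 - p) * (‖z.snd - grad f z.proj‖ₑ ^ 2
            + ENNReal.ofReal ((L * (η * ‖z.snd‖)) ^ 2 / b))) := by
  have := isProbabilityMeasure_stepLaw (D := D) (B := B) (b := b) hp0 hp1
  set v : TangentBundle 𝓘(ℝ, E) M := ⟨z.proj, -(η • z.snd)⟩ with hv
  change ∫⁻ s : StepSample Ξ B b, (ENNReal.ofReal (f (expMap v) - fstar)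
    + ENNReal.ofReal c * ‖(show TangentSpace 𝓘(ℝ, E) (expMap v) from
      (step F η z s).snd) - grad f (expMap v)‖ₑ ^ 2) ∂(stepLaw D B b p) ≤ _
  rw [lintegral_add_left measurable_const, lintegral_const, measure_univ, mul_one,
    lintegral_const_mul' _ _ ENNReal.ofReal_ne_top]
  gcongr
  refine (lintegral_stepLaw_le _
    (fun ζ => ‖batchGrad E F ζ (expMap v) - grad f (expMap v)‖ₑ ^ 2)
    (fun ξ => ‖transport v z.snd + batchGrad E F ξ (expMap v)
        - transport v (batchGrad E F ξ v.proj) - grad f (expMap v)‖ₑ ^ 2)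
    (fun _ _ => rfl) (fun _ _ => rfl)).trans ?_
  gcongr
  · exact lintegral_batchGrad_sub_grad_le hint hunb hvar hB (expMap v)
  · have hnorm : ‖v.snd‖ = η * ‖z.snd‖ := by
      rw [← Real.norm_of_nonneg hη.le, ← norm_smul]
      exact norm_neg (η • z.snd)
    have hz : z.snd = (-η⁻¹) • v.snd := by
      change z.snd = (-η⁻¹) • -(η • z.snd)
      rw [smul_neg, neg_smul, neg_neg, smul_smul, inv_mul_cancel₀ hη.ne', one_smul]
    have h := lintegral_recursive_estimator_le hM hsmooth hint hunb hb v z.snd (-η⁻¹) hz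
    rwa [hnorm] at h

/-- The parameters make the Lyapunov function decrease in expectation. -/
lemma lyapunov_decrease (hM : GeodesicallyComplete E M)
    (hF : ∀ x, Integrable (F x) D) (hf : ∀ x, f x = ∫ ξ, F x ξ ∂D)
    (hsmooth : ∀ ξ, IsGeodesicallySmooth E L (fun x => F x ξ))
    (hint : ∀ x, Integrable (fun ξ => grad (E := E) (fun y => F y ξ) x) D)
    (hunb : ∀ x, ∫ ξ, grad (E := E) (fun y => F y ξ) x ∂D = grad f x)
    (hvar : ∀ x, ∫⁻ ξ, ‖grad (E := E) (fun y => F y ξ) x - grad f x‖ₑ ^ 2 ∂D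
      ≤ ENNReal.ofReal (σ ^ 2))
    (hfstar : ∀ x, fstar ≤ f x)
    (hB : 0 < B) (hb : 0 < b) (hη : 0 < η) (hp0 : 0 < p) (hp1 : p ≤ 1)
    (hstep : (1 - p) / (p * b) * (L * η) ^ 2 + L * η ≤ 1) (z : TangentBundle 𝓘(ℝ, E) M) :
    ENNReal.ofReal (η / 2) * ‖grad (E := E) f z.proj‖ₑ ^ 2
        + ∫⁻ s : StepSample Ξ B b, lyapunov f fstar (η / (2 * p)) (step F η z s)
            ∂(stepLaw D B b p)
      ≤ lyapunov f fstar (η / (2 * p)) z + ENNReal.ofReal (η * σ ^ 2 / (2 * B)) := by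
  refine (add_le_add_right
    (lintegral_lyapunov_step_le hM hsmooth hint hunb hvar hB hb hη hp0.le hp1 z) _).trans ?_
  have hdesc := integral_le_expMap hM hF hf hsmooth hint hunb ⟨z.proj, -(η • z.snd)⟩
  set y := expMap (⟨z.proj, -(η • z.snd)⟩ : TangentBundle 𝓘(ℝ, E) M)
  have h1p : 0 ≤ 1 - p := by linarith
  have hB' : (0 : ℝ) < B := Nat.cast_pos.2 hB
  have hb' : (0 : ℝ) < b := Nat.cast_pos.2 hb
  have hy := sub_nonneg.2 (hfstar y)
  have hx := sub_nonneg.2 (hfstar z.proj)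
  simp only [lyapunov, enorm_sq_eq_ofReal]
  rw [← ENNReal.ofReal_mul (by positivity), ← ENNReal.ofReal_mul (by positivity),
    ← ENNReal.ofReal_add (by positivity) (by positivity), ← ENNReal.ofReal_mul (by positivity),
    ← ENNReal.ofReal_add (by positivity) (by positivity), ← ENNReal.ofReal_mul (by positivity),
    ← ENNReal.ofReal_add (by positivity) (by positivity),
    ← ENNReal.ofReal_add (by positivity) (by positivity), ← ENNReal.ofReal_mul (by positivity),
    ← ENNReal.ofReal_add (by positivity) (by positivity),
    ← ENNReal.ofReal_add (by positivity) (by positivity)]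
  refine ENNReal.ofReal_le_ofReal ?_
  have e1 : inner ℝ (grad f z.proj) (-(η • z.snd)) = -(η * inner ℝ (grad f z.proj) z.snd) := by
    rw [inner_neg_right, real_inner_smul_right]
  have e2 : ‖-(η • z.snd)‖ ^ 2 = η ^ 2 * ‖z.snd‖ ^ 2 := by
    rw [norm_neg, norm_smul, mul_pow, Real.norm_eq_abs, sq_abs]
  have e3 : ‖z.snd - grad f z.proj‖ ^ 2
      = ‖z.snd‖ ^ 2 - 2 * inner ℝ (grad f z.proj) z.snd + ‖grad (E := E) f z.proj‖ ^ 2 := by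
    rw [norm_sub_sq_real, real_inner_comm]
  simp only at hdesc
  rw [e1, e2] at hdesc
  set G := ‖z.snd‖ ^ 2 with hG
  set e := ‖z.snd - grad f z.proj‖ ^ 2
  set N := ‖grad (E := E) f z.proj‖ ^ 2
  set I := inner ℝ (grad f z.proj) z.snd
  have hG0 : 0 ≤ G := sq_nonneg _
  have e4 : (L * (η * ‖z.snd‖)) ^ 2 = (L * η) ^ 2 * G := by rw [hG]; ring
  rw [e4]
  -- The weight `η / (2 * p)` times `1 - p` is the weight minus `η / 2`; this releases exactly the
  -- error term that polarization (`e3`) puts into the descent inequality.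
  have e5 : η / (2 * p) * (p * (σ ^ 2 / B) + (1 - p) * (e + (L * η) ^ 2 * G / b))
      = η * σ ^ 2 / (2 * B) + (η / (2 * p) * e - η / 2 * e)
        + η / 2 * G * ((1 - p) / (p * b) * (L * η) ^ 2) := by
    field_simp
    ring
  rw [e5]
  -- The step size condition makes the remaining coefficient of ‖g‖² nonpositive.
  have h3 := mul_le_mul_of_nonneg_left hstep (show 0 ≤ η / 2 * G by positivity)
  linear_combination hdesc + h3 - η / 2 * e3

end Convergence

/-! ### Arithmetic of the parameters -/

section Parameters

/-- With s = √r the left side is (s² + s + 1)/(1 + s)². -/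
lemma stepsize_condition {L η r : ℝ} (hL : 0 < L) (hr : 0 ≤ r) (hη : η = 1 / (L * (1 + √r))) :
    r * (L * η) ^ 2 + L * η ≤ 1 := by
  have hq : 0 ≤ √r := Real.sqrt_nonneg r
  have h1 : L * η = 1 / (1 + √r) := by
    rw [hη]
    field_simp
  have h2 : r = √r ^ 2 := (Real.sq_sqrt hr).symm
  rw [h1]
  nth_rw 1 [h2]
  rw [one_div_pow, mul_one_div, div_add_div _ _ (by positivity) (by positivity),
    div_le_one (by positivity)]
  nlinarith [mul_nonneg hq hq, mul_nonneg (mul_nonneg hq hq) hq]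

/-- The choice of `B` lets the noise use at most half of the budget ηε²/2 of each step. In the other
half, the summand `4 * δ / (ε ^ 2 * η)` of `K` pays for the initial gap and `1 / p` for the initial
estimator error. -/
lemma stationarity_budget {δ σ ε η p : ℝ} {B K : ℕ} (hε : 0 < ε) (hη : 0 < η) (hp : 0 < p)
    (hB0 : 0 < B) (hB : 2 * σ ^ 2 / ε ^ 2 ≤ B) (hK : 4 * δ / (ε ^ 2 * η) + 1 / p ≤ K) :
    δ + η / (2 * p) * (σ ^ 2 / B) + K * (η * σ ^ 2 / (2 * B)) ≤ η / 2 * (K * ε ^ 2) := by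
  have hB' : (0 : ℝ) < B := Nat.cast_pos.2 hB0
  have h1 : σ ^ 2 / B ≤ ε ^ 2 / 2 := by
    rw [div_le_iff₀ (by positivity)] at hB
    rw [div_le_iff₀ hB']
    linarith
  have h2 : δ + η / (2 * p) * (ε ^ 2 / 2) ≤ K * (η * ε ^ 2 / 4) := by
    have h := mul_le_mul_of_nonneg_right hK (show 0 ≤ η * ε ^ 2 / 4 by positivity)
    have e : (4 * δ / (ε ^ 2 * η) + 1 / p) * (η * ε ^ 2 / 4)
        = δ + η / (2 * p) * (ε ^ 2 / 2) := by
      field_simp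
      ring
    linarith
  have h3 : η / (2 * p) * (σ ^ 2 / B) ≤ η / (2 * p) * (ε ^ 2 / 2) := by gcongr
  have h4 : K * (η * σ ^ 2 / (2 * B)) ≤ K * (η * ε ^ 2 / 4) := by
    have e : η * σ ^ 2 / (2 * B) = η / 2 * (σ ^ 2 / B) := by field_simp
    rw [e]
    have : η / 2 * (σ ^ 2 / B) ≤ η / 2 * (ε ^ 2 / 2) := by gcongr
    gcongr
    linarith
  linarith

/-- The choice of `p` gives (1 - p)b = pB, so a step costs 3pB ≤ 3b, and 1/η = L(1 + √B/b) with b ≤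
√B gives b/η ≤ 2L√B. The total is at most 7B + 24Lδ√B/ε². As ε ≤ σ absorbs rounding, B ≤ 3(σ/ε)² and
√B ≤ 2σ/ε, with constants 21 and 48. -/
lemma gradCount_budget {δ σ ε η p L : ℝ} {B b K : ℕ} (hδ : 0 ≤ δ) (hL : 0 < L) (hε : 0 < ε)
    (hσ : 0 < σ) (hεσ : ε ≤ σ) (hB : B = ⌈2 * σ ^ 2 / ε ^ 2⌉₊) (hb : 1 ≤ b)
    (hbB : (b : ℝ) ≤ √(B : ℝ)) (hp : p = b / (B + b))
    (hη : η = 1 / (L * (1 + √((1 - p) / (p * b)))))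
    (hK : K = ⌈4 * δ / (ε ^ 2 * η) + 1 / p⌉₊) :
    B + K * (p * B + (1 - p) * (2 * b)) ≤ 50 * (σ ^ 2 / ε ^ 2 + L * δ * σ / ε ^ 3) := by
  have hb' : (1 : ℝ) ≤ b := by exact_mod_cast hb
  have hb0 : (0 : ℝ) < b := by linarith
  have hB1 : (1 : ℝ) ≤ B := by
    have : 0 < B := by rw [hB]; exact Nat.ceil_pos.2 (by positivity)
    exact_mod_cast this
  have hB0 : (0 : ℝ) < B := by linarith
  set q := √(B : ℝ) with hq
  have hqq : q ^ 2 = B := Real.sq_sqrt hB0.le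
  have hq1 : 1 ≤ q := hb'.trans hbB
  have hp0 : 0 < p := by rw [hp]; positivity
  have hroot : √((1 - p) / (p * b)) = q / b := by
    have e : (1 - p) / (p * b) = (q / b) ^ 2 := by
      rw [div_pow, hqq, hp]
      field_simp
      ring
    rw [e, Real.sqrt_sq (by positivity)]
  have hηinv : 1 / η = L * (1 + q / b) := by rw [hη, hroot, one_div_one_div]
  have hη0 : 0 < η := by rw [hη]; positivity
  have hpB : p * B ≤ b := by
    rw [hp, div_mul_eq_mul_div, div_le_iff₀ (by positivity)]
    nlinarith
  have hcost : p * B + (1 - p) * (2 * b) = 3 * (p * B) := by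
    rw [hp]
    field_simp
    ring
  have hKle : (K : ℝ) ≤ 4 * δ / (ε ^ 2 * η) + 1 / p + 1 := by
    rw [hK]
    exact (Nat.ceil_lt_add_one (by positivity)).le
  have hKB : (K : ℝ) * (p * B) ≤ 8 * L * δ * q / ε ^ 2 + 2 * B := by
    have h1 := mul_le_mul_of_nonneg_right hKle (show 0 ≤ p * B by positivity)
    have h2 : 4 * δ / (ε ^ 2 * η) * (p * B) ≤ 8 * L * δ * q / ε ^ 2 := by
      have e : 4 * δ / (ε ^ 2 * η) * (p * B) = 4 * δ / ε ^ 2 * (1 / η * (p * B)) := by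
        field_simp
      have h3 : 1 / η * (p * B) ≤ 2 * L * q := by
        rw [hηinv]
        calc L * (1 + q / b) * (p * B) ≤ L * (1 + q / b) * b := by gcongr
          _ = L * (b + q) := by field_simp
          _ ≤ L * (q + q) := by gcongr
          _ = 2 * L * q := by ring
      rw [e]
      calc 4 * δ / ε ^ 2 * (1 / η * (p * B)) ≤ 4 * δ / ε ^ 2 * (2 * L * q) := by gcongr
        _ = 8 * L * δ * q / ε ^ 2 := by ring
    have h4 : 1 / p * (p * B) = B := by field_simp
    have h5 : p * B ≤ B := by nlinarith
    linarith
  have hσε : 1 ≤ σ / ε := (one_le_div hε).2 hεσ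
  have hBle : (B : ℝ) ≤ 3 * (σ / ε) ^ 2 := by
    have h1 : (B : ℝ) ≤ 2 * σ ^ 2 / ε ^ 2 + 1 := by
      rw [hB]
      exact (Nat.ceil_lt_add_one (by positivity)).le
    have h2 : 2 * σ ^ 2 / ε ^ 2 = 2 * (σ / ε) ^ 2 := by rw [div_pow]; ring
    nlinarith
  have hqle : q ≤ 2 * (σ / ε) := by
    refine Real.sqrt_le_iff.2 ⟨by positivity, ?_⟩
    nlinarith
  have h24 : 24 * L * δ * q / ε ^ 2 ≤ 48 * (L * δ * σ / ε ^ 3) := by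
    calc 24 * L * δ * q / ε ^ 2 ≤ 24 * L * δ * (2 * (σ / ε)) / ε ^ 2 := by gcongr
      _ = 48 * (L * δ * σ / ε ^ 3) := by field_simp; ring
  have hpos : 0 ≤ L * δ * σ / ε ^ 3 := by positivity
  have hpos' : 0 ≤ (σ / ε) ^ 2 := by positivity
  have e : 24 * L * δ * q / ε ^ 2 = 3 * (8 * L * δ * q / ε ^ 2) := by ring
  rw [hcost, ← div_pow]
  linarith

end Parameters

end RPAGE

end

/-! ### Stationarity and complexity of the method -/

theorem corollary9
    -- a geodesically complete smooth Riemannian manifold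
    {E : Type*} [NormedAddCommGroup E] [NormedSpace ℝ E] [FiniteDimensional ℝ E]
    {M : Type*} [TopologicalSpace M] [T2Space M] [SecondCountableTopology M]
    [ChartedSpace E M] [IsManifold 𝓘(ℝ, E) ∞ M]
    [RiemannianBundle (fun x : M => TangentSpace 𝓘(ℝ, E) x)]
    [IsContMDiffRiemannianBundle 𝓘(ℝ, E) ∞ E (fun x : M => TangentSpace 𝓘(ℝ, E) x)]
    (hM : RPAGE.GeodesicallyComplete E M)
    -- the online problem: minimize `f x = 𝔼 [F x ξ]`, `ξ ∼ D`
    {Ξ : Type*} [MeasurableSpace Ξ] (D : Measure Ξ) [IsProbabilityMeasure D]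
    (F : M → Ξ → ℝ) (f : M → ℝ)
    (hF : ∀ x, Integrable (F x) D) (hf : ∀ x, f x = ∫ ξ, F x ξ ∂D)
    (hfd : MDifferentiable 𝓘(ℝ, E) 𝓘(ℝ, ℝ) f)
    -- geodesic smoothness of every `F · ξ`
    (L : ℝ) (hL : 0 < L)
    (hsmooth : ∀ ξ, RPAGE.IsGeodesicallySmooth E L (fun x => F x ξ))
    -- unbiasedness
    (hint : ∀ x, Integrable (fun ξ => RPAGE.grad (E := E) (fun y => F y ξ) x) D)
    (hunb : ∀ x, ∫ ξ, RPAGE.grad (E := E) (fun y => F y ξ) x ∂D = RPAGE.grad f x)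
    -- bounded variance
    (σ : ℝ) (hσ : 0 < σ)
    (hvar : ∀ x, ∫⁻ ξ, ‖RPAGE.grad (E := E) (fun y => F y ξ) x - RPAGE.grad f x‖ₑ ^ 2 ∂D
      ≤ ENNReal.ofReal (σ ^ 2))
    -- uniform lower bound, initial point
    (fstar : ℝ) (hfstar : ∀ x, fstar ≤ f x) (x₀ : M)
    -- parameters
    (ε : ℝ) (hε : 0 < ε)
    (B : ℕ) (hB : B = ⌈2 * σ ^ 2 / ε ^ 2⌉₊)
    (b : ℕ) (hb : 1 ≤ b) (hbB : (b : ℝ) ≤ √(B : ℝ))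
    (p : ℝ) (hp : p = b / (B + b))
    (η : ℝ) (hη : η = 1 / (L * (1 + √((1 - p) / (p * b)))))
    (K : ℕ) (hK : K = ⌈4 * (f x₀ - fstar) / (ε ^ 2 * η) + 1 / p⌉₊) :
    -- the output, uniformly random among `x^0, …, x^{K-1}`, is `ε`-stationary in expectation
    (∫⁻ q : Fin K × ((Fin B → Ξ) × (Fin K → RPAGE.StepSample Ξ B b)),
        ‖RPAGE.grad (E := E) f (RPAGE.iterates (E := E) F η x₀ q.2 q.1.castSucc).proj‖ₑ ^ 2
        ∂((ProbabilityTheory.uniformOn Set.univ).prod (RPAGE.runLaw D B b p K))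
      ≤ ENNReal.ofReal (ε ^ 2)) ∧
    (∫⁻ q : Fin K × ((Fin B → Ξ) × (Fin K → RPAGE.StepSample Ξ B b)),
        ‖RPAGE.grad (E := E) f (RPAGE.iterates (E := E) F η x₀ q.2 q.1.castSucc).proj‖ₑ
        ∂((ProbabilityTheory.uniformOn Set.univ).prod (RPAGE.runLaw D B b p K))
      ≤ ENNReal.ofReal ε) ∧
    -- the expected number of stochastic gradient computations
    (ε ≤ σ →
      ∫⁻ r, (RPAGE.gradCount r : ENNReal) ∂(RPAGE.runLaw D B b p K)
        ≤ ENNReal.ofReal (50 * (σ ^ 2 / ε ^ 2 + L * (f x₀ - fstar) * σ / ε ^ 3))) := by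
  have hB0 : 0 < B := by rw [hB]; exact Nat.ceil_pos.2 (by positivity)
  have hb0 : 0 < b := hb
  have hB' : (0 : ℝ) < B := Nat.cast_pos.2 hB0
  have hb' : (0 : ℝ) < b := Nat.cast_pos.2 hb0
  have hp0 : 0 < p := by rw [hp]; positivity
  have hp1 : p ≤ 1 := by rw [hp]; exact (div_le_one (by positivity)).2 (by linarith)
  have hr : 0 ≤ (1 - p) / (p * b) := div_nonneg (by linarith) (by positivity)
  have hη0 : 0 < η := by rw [hη]; positivity
  have hδ : 0 ≤ f x₀ - fstar := sub_nonneg.2 (hfstar x₀)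
  have hBle : 2 * σ ^ 2 / ε ^ 2 ≤ B := hB ▸ Nat.le_ceil _
  have hKle : 4 * (f x₀ - fstar) / (ε ^ 2 * η) + 1 / p ≤ K := hK ▸ Nat.le_ceil _
  have hK0 : 0 < K := by rw [hK]; exact Nat.ceil_pos.2 (by positivity)
  have := RPAGE.isProbabilityMeasure_stepLaw (D := D) (B := B) (b := b) hp0.le hp1
  have : IsProbabilityMeasure (RPAGE.runLaw D B b p K) := by
    unfold RPAGE.runLaw
    infer_instance
  have hsum : ∫⁻ r, ∑ i : Fin K,
      ‖RPAGE.grad (E := E) f (RPAGE.iterates (E := E) F η x₀ r i.castSucc).proj‖ₑ ^ 2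
        ∂(RPAGE.runLaw D B b p K) ≤ K * ENNReal.ofReal (ε ^ 2) := by
    have hA0 : ENNReal.ofReal (η / 2) ≠ 0 := by simpa using hη0
    rw [← ENNReal.mul_le_mul_iff_right hA0 ENNReal.ofReal_ne_top,
      ← lintegral_const_mul' _ _ ENNReal.ofReal_ne_top]
    -- For a fixed initial minibatch the iterates are, by definition, the orbit of (x⁰, g⁰) under
    -- `RPAGE.step`.
    have hrun := RPAGE.lintegral_pi_sum_orbit_le (RPAGE.stepLaw D B b p) (RPAGE.step F η)
      (fun z => ENNReal.ofReal (η / 2) * ‖RPAGE.grad (E := E) f z.proj‖ₑ ^ 2)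
      (RPAGE.lyapunov f fstar (η / (2 * p))) _
      (RPAGE.lyapunov_decrease hM hF hf hsmooth hint hunb hvar hfstar hB0 hb0 hη0 hp0 hp1
        (RPAGE.stepsize_condition hL hr hη)) K
    refine (lintegral_prod_le _).trans ?_
    simp_rw [Finset.mul_sum]
    refine (lintegral_mono fun ζ => hrun ⟨x₀, RPAGE.batchGrad E F ζ x₀⟩).trans ?_
    rw [lintegral_add_right _ measurable_const, lintegral_const, measure_univ, mul_one]
    simp only [RPAGE.lyapunov]
    rw [lintegral_add_left measurable_const, lintegral_const, measure_univ, mul_one,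
      lintegral_const_mul' _ _ ENNReal.ofReal_ne_top]
    grw [RPAGE.lintegral_batchGrad_sub_grad_le hint hunb hvar hB0 x₀]
    rw [← ENNReal.ofReal_natCast, ← ENNReal.ofReal_mul (by positivity),
      ← ENNReal.ofReal_mul (by positivity), ← ENNReal.ofReal_mul (by positivity),
      ← ENNReal.ofReal_mul (by positivity), ← ENNReal.ofReal_add hδ (by positivity),
      ← ENNReal.ofReal_add (by positivity) (by positivity)]
    exact ENNReal.ofReal_le_ofReal (RPAGE.stationarity_budget hε hη0 hp0 hB0 hBle hKle)
  have hsq : ∫⁻ q : Fin K × ((Fin B → Ξ) × (Fin K → RPAGE.StepSample Ξ B b)),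
      ‖RPAGE.grad (E := E) f (RPAGE.iterates (E := E) F η x₀ q.2 q.1.castSucc).proj‖ₑ ^ 2
        ∂((ProbabilityTheory.uniformOn Set.univ).prod (RPAGE.runLaw D B b p K))
      ≤ ENNReal.ofReal (ε ^ 2) := by
    refine (RPAGE.lintegral_uniformOn_prod_le (RPAGE.runLaw D B b p K) K fun i r =>
      ‖RPAGE.grad (E := E) f (RPAGE.iterates (E := E) F η x₀ r i.castSucc).proj‖ₑ ^ 2).trans ?_
    grw [hsum]
    rw [← mul_assoc, ENNReal.inv_mul_cancel (by simpa using hK0.ne') (ENNReal.natCast_ne_top K),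
      one_mul]
  refine ⟨hsq, ?_, fun hεσ => ?_⟩
  · have : Nonempty (Fin K) := ⟨⟨0, hK0⟩⟩
    have : IsProbabilityMeasure
        (ProbabilityTheory.uniformOn (Set.univ : Set (Fin K))) :=
      ProbabilityTheory.isProbabilityMeasure_uniformOn Set.finite_univ Set.univ_nonempty
    exact RPAGE.lintegral_le_of_lintegral_sq_le hε hsq
  · exact (RPAGE.lintegral_gradCount_le hp0.le hp1).trans (ENNReal.ofReal_le_ofReal
      (RPAGE.gradCount_budget hδ hL hε hσ hεσ hB hb hbB hp hη hK))
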